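/- Let $k=\mathbb C$. For a group $G$, an $\mathrm{RSR}(G,r,\overrightarrow{\rho},u)$ consists of a ramification $r=\sum_C r_C\,C$ ($C$ runs over the conjugacy classes of $G$, each $r_C$ is a cardinal), an element $u(C)\in C$ for each class, and, for each $C$ with $r_C\neq 0$, a family $\{\rho_C^{(i)}\}_{i\in I_C(r,u)}$ of irreducible complex representations of the centralizer $G^{u(C)}$ of $u(C)$ in $G$, with $\dim\bigoplus_i\rho_C^{(i)}=r_C$. Choose bases $\{x_C^{(i,j)}\}_{j\in J_C(i)}$ of the representation spaces, regarded as right modules by $x\cdot z=\rho_C^{(i)}(z^{-1})x$, and right coset decompositions $G=\bigcup_\theta G^{u(C)}g_\theta$. Let $Q$ be the quiver with vertex set $G$ and with arrows $a_{y,x}^{(i,j)}$ from $x$ to $y$, $i\in I_C(r,u)$, $j\in J_C(i)$, whenever $x^{-1}y\in C$. Its arrow space $kQ_1$ is a $kG$-Hopf bimodule under the coactions $a\mapsto t(a)\otimes a$ and $a\mapsto a\otimes s(a)$ (where $s(a)$ and $t(a)$ are the start and the end of $a$) and the actions $$h\cdot a_{y,x}^{(i,j)}=a_{hy,hx}^{(i,j)},\qquad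 a_{y,x}^{(i,j)}\cdot h=\sum_s k^{(i,j,s)}_{C,h}\,a_{yh,xh}^{(i,s)},$$ where $x^{-1}y=g_\theta^{-1}u(C)g_\theta$, $g_\theta h=\zeta_\theta(h)g_{\theta'}$ with $\zeta_\theta(h)\in G^{u(C)}$, and $x_C^{(i,j)}\cdot\zeta_\theta(h)=\sum_s k^{(i,j,s)}_{C,h}x_C^{(i,s)}$. The co-path Hopf algebra $kQ^c(G,r,\overrightarrow{\rho},u)$ is the path coalgebra of $Q$ with the graded Hopf algebra structure determined by $kG$ and this bimodule; $kG[kQ_1^c,G,r,\overrightarrow{\rho},u]$ is its Hopf subalgebra generated by $kG$ and $kQ_1$; and $\mathfrak B(G,r,\overrightarrow{\rho},u)$ is the Nichols algebra of the Yetter–Drinfeld module $kQ_1^1$ over $kG$ spanned by the arrows starting at $1$, with the adjoint action $m\mapsto h\cdot m\cdot h^{-1}$ and the coaction $a\mapsto t(a)\otimes a$. Let $D$ be a subgroup of $G$; for a conjugacy class $C$ of $D$ let $C_G$ be the conjugacy class of $G$ containing it. Write $\mathrm{RSR}(D,r,\overrightarrow{\rho},u)\le\mathrm{RSR}(G,r',\overrightarrow{\rho'},u')$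 if for every class $C$ of $D$ with $r_C\ne0$ one has $r_C\le r'_{C_G}$, $u(C)=u'(C_G)$, $I_C(r,u)\subseteq I_{C_G}(r',u')$, and for every $i\in I_C(r,u)$ the representation $\rho_C^{(i)}$ is isomorphic to a subrepresentation of the restriction of $\rho'^{(i)}_{C_G}$ to $D^{u(C)}$. **Proposition.** Let $D$ be a subgroup of $G$ with $\mathrm{RSR}(D,r,\overrightarrow{\rho},u)\le\mathrm{RSR}(G,r',\overrightarrow{\rho'},u')$. Then, for all choices of bases and coset representatives for the two systems: (i) there is an injective Hopf algebra map from $kQ^c(D,r,\overrightarrow{\rho},u)$ to $kQ'^c(G,r',\overrightarrow{\rho'},u')$ that extends the inclusion $kD\subseteq kG$; (ii) such a map can be chosen so that it restricts to an injective Hopf algebra map from $kD[kQ_1^c,D,r,\overrightarrow{\rho},u]$ to $kG[kQ_1'^c,G,r',\overrightarrow{\rho'},u']$; (iii) if $G$ is finite and $\mathfrak B(G,r',\overrightarrow{\rho'},u')$ is finite dimensional, then so is $\mathfrak B(D,r,\overrightarrow{\rho},u)$. -/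

import Mathlib

open scoped TensorProduct DirectSum

universe u v

noncomputable section

/-! ### Hopf subalgebras -/

section HopfSub
variable (k : Type*) (H : Type*) [Field k] [Ring H] [HopfAlgebra k H]

/-- A Hopf subalgebra: a subalgebra `K` with `Δ(K) ⊆ K ⊗ K` and `S(K) ⊆ K`. -/
structure HopfSubalgebra extends Subalgebra k H where
  comul_mem' : ∀ x ∈ carrier, Coalgebra.comul (R := k) x ∈
    (Algebra.TensorProduct.map toSubalgebra.val toSubalgebra.val).range
  antipode_mem' : ∀ x ∈ carrier, HopfAlgebra.antipode k x ∈ carrier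
end HopfSub

namespace HopfSubalgebra
variable {k : Type*} {H : Type*} [Field k] [Ring H] [HopfAlgebra k H] (K : HopfSubalgebra k H)

theorem map_val_injective :
    Function.Injective (Algebra.TensorProduct.map K.toSubalgebra.val K.toSubalgebra.val) :=
  TensorProduct.map_injective_of_flat_flat K.toSubalgebra.val.toLinearMap
    K.toSubalgebra.val.toLinearMap Subtype.val_injective Subtype.val_injective

/-- The restricted comultiplication, as an algebra map. -/
def comulAlgHom : K.toSubalgebra →ₐ[k] K.toSubalgebra ⊗[k] K.toSubalgebra :=
  (AlgEquiv.ofInjective _ K.map_val_injective).symm.toAlgHom.comp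
    (((Bialgebra.comulAlgHom k H).comp K.toSubalgebra.val).codRestrict _
      fun x => K.comul_mem' x x.2)

theorem map_comulAlgHom (x : K.toSubalgebra) :
    Algebra.TensorProduct.map K.toSubalgebra.val K.toSubalgebra.val (K.comulAlgHom x) =
      Coalgebra.comul (R := k) (x : H) := by
  have := AlgEquiv.apply_symm_apply (AlgEquiv.ofInjective _ K.map_val_injective)
    ((((Bialgebra.comulAlgHom k H).comp K.toSubalgebra.val).codRestrict _
      fun x => K.comul_mem' x x.2) x)
  exact congrArg Subtype.val this

theorem map_comulAlgHom' : TensorProduct.map K.toSubalgebra.val.toLinearMap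
    K.toSubalgebra.val.toLinearMap ∘ₗ K.comulAlgHom.toLinearMap =
      Coalgebra.comul ∘ₗ K.toSubalgebra.val.toLinearMap :=
  LinearMap.ext K.map_comulAlgHom

/-- The restricted counit. -/
def counitAlgHom : K.toSubalgebra →ₐ[k] k := (Bialgebra.counitAlgHom k H).comp K.toSubalgebra.val

instance : Coalgebra k K.toSubalgebra where
  comul := K.comulAlgHom.toLinearMap
  counit := K.counitAlgHom.toLinearMap
  coassoc := by
    have hi : Function.Injective (TensorProduct.map K.toSubalgebra.val.toLinearMap
        (TensorProduct.map K.toSubalgebra.val.toLinearMap K.toSubalgebra.val.toLinearMap)) :=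
      TensorProduct.map_injective_of_flat_flat _ _ Subtype.val_injective K.map_val_injective
    ext x
    apply hi
    have h1 : ∀ t : K.toSubalgebra ⊗[k] K.toSubalgebra,
        TensorProduct.map K.toSubalgebra.val.toLinearMap
          (TensorProduct.map K.toSubalgebra.val.toLinearMap K.toSubalgebra.val.toLinearMap)
          (TensorProduct.assoc k _ _ _ (K.comulAlgHom.toLinearMap.rTensor _ t)) =
        TensorProduct.assoc k _ _ _ ((Coalgebra.comul (R := k) (A := H)).rTensor H
          (TensorProduct.map K.toSubalgebra.val.toLinearMap K.toSubalgebra.val.toLinearMap t)) := by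
      intro t
      rw [← LinearMap.comp_apply (LinearMap.rTensor _ _), LinearMap.rTensor_comp_map,
        ← K.map_comulAlgHom']
      induction t with
      | zero => simp
      | add s t hs ht => simp only [map_add, hs, ht]
      | tmul s t =>
        simp only [LinearMap.rTensor_tmul, TensorProduct.map_tmul, LinearMap.comp_apply]
        generalize K.comulAlgHom.toLinearMap s = u
        induction u with
        | zero => simp
        | add s t hs ht => simp only [map_add, hs, ht, TensorProduct.add_tmul]
        | tmul s t => simp
    have h2 : ∀ t : K.toSubalgebra ⊗[k] K.toSubalgebra,
        TensorProduct.map K.toSubalgebra.val.toLinearMap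
          (TensorProduct.map K.toSubalgebra.val.toLinearMap K.toSubalgebra.val.toLinearMap)
          (K.comulAlgHom.toLinearMap.lTensor _ t) =
        (Coalgebra.comul (R := k) (A := H)).lTensor H
          (TensorProduct.map K.toSubalgebra.val.toLinearMap K.toSubalgebra.val.toLinearMap t) := by
      intro t
      rw [← LinearMap.comp_apply (LinearMap.lTensor _ _), LinearMap.lTensor_comp_map,
        ← K.map_comulAlgHom', ← LinearMap.comp_apply, LinearMap.map_comp_lTensor]
    have h3 := K.map_comulAlgHom x
    change TensorProduct.map K.toSubalgebra.val.toLinearMap K.toSubalgebra.val.toLinearMap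
      (K.comulAlgHom.toLinearMap x) = _ at h3
    refine (h1 _).trans (Eq.trans ?_ (h2 _).symm)
    rw [h3]
    exact Coalgebra.coassoc_apply _
  rTensor_counit_comp_comul := by
    ext x
    have hi : Function.Injective (K.toSubalgebra.val.toLinearMap.lTensor k) :=
      Module.Flat.lTensor_preserves_injective_linearMap _ Subtype.val_injective
    apply hi
    have h3 := K.map_comulAlgHom x
    change TensorProduct.map K.toSubalgebra.val.toLinearMap K.toSubalgebra.val.toLinearMap
      (K.comulAlgHom.toLinearMap x) = _ at h3
    have := Coalgebra.rTensor_counit_comul (R := k) (x : H)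
    rw [← h3, ← LinearMap.comp_apply, LinearMap.rTensor_comp_map] at this
    simp only [LinearMap.comp_apply]
    rw [← LinearMap.comp_apply, LinearMap.lTensor_comp_rTensor]
    exact this
  lTensor_counit_comp_comul := by
    ext x
    have hi : Function.Injective (K.toSubalgebra.val.toLinearMap.rTensor k) :=
      Module.Flat.rTensor_preserves_injective_linearMap _ Subtype.val_injective
    apply hi
    have h3 := K.map_comulAlgHom x
    change TensorProduct.map K.toSubalgebra.val.toLinearMap K.toSubalgebra.val.toLinearMap
      (K.comulAlgHom.toLinearMap x) = _ at h3
    have := Coalgebra.lTensor_counit_comul (R := k) (x : H)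
    rw [← h3, ← LinearMap.comp_apply, LinearMap.lTensor_comp_map] at this
    simp only [LinearMap.comp_apply]
    rw [← LinearMap.comp_apply, LinearMap.rTensor_comp_lTensor]
    exact this

instance : Bialgebra k K.toSubalgebra :=
  Bialgebra.mk' k K.toSubalgebra (map_one K.counitAlgHom) (map_mul K.counitAlgHom _ _)
    (map_one K.comulAlgHom) (map_mul K.comulAlgHom _ _)

/-- The restricted antipode. -/
def antipodeLin : K.toSubalgebra →ₗ[k] K.toSubalgebra where
  toFun x := ⟨HopfAlgebra.antipode k (x : H), K.antipode_mem' x x.2⟩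
  map_add' _ _ := Subtype.ext (map_add _ _ _)
  map_smul' c x := Subtype.ext (map_smul _ c (x : H))

instance : HopfAlgebra k K.toSubalgebra where
  antipode := K.antipodeLin
  mul_antipode_rTensor_comul := by
    have h1 : ∀ t : K.toSubalgebra ⊗[k] K.toSubalgebra, (LinearMap.mul' k K.toSubalgebra
        (K.antipodeLin.rTensor K.toSubalgebra t) : H)
        = LinearMap.mul' k H ((HopfAlgebra.antipode k).rTensor H
          (Algebra.TensorProduct.map K.toSubalgebra.val K.toSubalgebra.val t)) := by
      intro t
      induction t with
      | zero => simp
      | add s t hs ht => simp only [map_add, ← hs, ← ht]; rfl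
      | tmul s t => simp; rfl
    refine LinearMap.ext fun x => Subtype.ext ?_
    refine (h1 _).trans ?_
    exact congr(LinearMap.mul' k H ((HopfAlgebra.antipode k).rTensor H $(K.map_comulAlgHom x))).trans
      (HopfAlgebra.mul_antipode_rTensor_comul_apply _)
  mul_antipode_lTensor_comul := by
    have h1 : ∀ t : K.toSubalgebra ⊗[k] K.toSubalgebra, (LinearMap.mul' k K.toSubalgebra
        (K.antipodeLin.lTensor K.toSubalgebra t) : H)
        = LinearMap.mul' k H ((HopfAlgebra.antipode k).lTensor H
          (Algebra.TensorProduct.map K.toSubalgebra.val K.toSubalgebra.val t)) := by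
      intro t
      induction t with
      | zero => simp
      | add s t hs ht => simp only [map_add, ← hs, ← ht]; rfl
      | tmul s t => simp; rfl
    refine LinearMap.ext fun x => Subtype.ext ?_
    refine (h1 _).trans ?_
    exact congr(LinearMap.mul' k H ((HopfAlgebra.antipode k).lTensor H $(K.map_comulAlgHom x))).trans
      (HopfAlgebra.mul_antipode_lTensor_comul_apply _)

end HopfSubalgebra

/-! ### The Hopf algebra of a quiver with an arrow Hopf bimodule -/

/-- A quiver with vertex set a group `G`, together with a `kG`-Hopf bimodule structure on the space
`kQ₁` spanned by its arrows. The coactions are those of the arrow comodule,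
`δ⁻(a) = t(a) ⊗ a` and `δ⁺(a) = a ⊗ s(a)`; the left and right `kG`-actions commute and are maps of
bicomodules, i.e. `g · a` is a combination of arrows from `g s(a)` to `g t(a)`, and `a · h` is a
combination of arrows from `s(a) h` to `t(a) h`. -/
structure HopfBimoduleQuiver (G : Type u) [Group G] where
  Arrow : Type v
  src : Arrow → G
  tgt : Arrow → G
  left : Representation ℂ G (Arrow →₀ ℂ)
  right : Representation ℂ Gᵐᵒᵖ (Arrow →₀ ℂ)
  left_right : ∀ (g h : G) (m : Arrow →₀ ℂ),
    left g (right (MulOpposite.op h) m) = right (MulOpposite.op h) (left g m)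
  left_mem : ∀ (g : G) (a : Arrow), left g (Finsupp.single a 1) ∈
    Finsupp.supported ℂ ℂ {b | src b = g * src a ∧ tgt b = g * tgt a}
  right_mem : ∀ (h : G) (a : Arrow), right (MulOpposite.op h) (Finsupp.single a 1) ∈
    Finsupp.supported ℂ ℂ {b | src b = src a * h ∧ tgt b = tgt a * h}

namespace HopfBimoduleQuiver

variable {G : Type u} [Group G] (Q : HopfBimoduleQuiver.{u, v} G)

/-- Paths `aₙ ⋯ a₁` with `s(aᵢ₊₁) = t(aᵢ)`, indexed by their end vertex; `vertex x` is the path of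
length `0` at `x`, and `cons a p` is the path `a p`, where `a` starts at the end vertex of `p`. -/
inductive PathTo : G → Type (max u v)
  | vertex (x : G) : PathTo x
  | cons (a : Q.Arrow) (p : PathTo (Q.src a)) : PathTo (Q.tgt a)

/-- All paths of the quiver. -/
abbrev Path : Type (max u v) := Σ y : G, Q.PathTo y

/-- The vector space underlying the path coalgebra: the paths form a basis. -/
def CoPath : Type (max u v) := Q.Path →₀ ℂ

instance : AddCommGroup Q.CoPath := inferInstanceAs (AddCommGroup (Q.Path →₀ ℂ))
instance : Module ℂ Q.CoPath := inferInstanceAs (Module ℂ (Q.Path →₀ ℂ))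

/-- The basis of paths. -/
def pathBasis : Module.Basis Q.Path ℂ Q.CoPath := ⟨LinearEquiv.refl ℂ (Q.Path →₀ ℂ)⟩

/-- The path `p` as an element of `kQᶜ`. -/
def path {y : G} (p : Q.PathTo y) : Q.CoPath := Q.pathBasis ⟨y, p⟩

/-- The vertex `x` as an element of `kQᶜ`. -/
def vert (x : G) : Q.CoPath := Q.path (.vertex x)

/-- Linear extension of a map defined on paths. -/
def extend {N : Type*} [AddCommMonoid N] [Module ℂ N] (f : ∀ {y : G}, Q.PathTo y → N) :
    Q.CoPath →ₗ[ℂ] N :=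
  Q.pathBasis.constr ℂ fun p => f p.2

open Classical in
/-- Prolong the path `p` by the arrow `a`; the value is `0` if `a` does not start where `p` ends. -/
def consPath (a : Q.Arrow) {y : G} (p : Q.PathTo y) : Q.CoPath :=
  if h : y = Q.src a then Q.path (.cons a (h ▸ p)) else 0

/-- The arrow `a` as an element of `kQ₁`. -/
abbrev arr (a : Q.Arrow) : Q.Arrow →₀ ℂ := Finsupp.single a 1

/-- Prolongation of paths, extended bilinearly to `kQ₁ × kQᶜ`. -/
def cons : (Q.Arrow →₀ ℂ) →ₗ[ℂ] Q.CoPath →ₗ[ℂ] Q.CoPath :=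
  Finsupp.linearCombination ℂ fun a => Q.extend (Q.consPath a)

/-- The inclusion of `kQ₁` in `kQᶜ`. -/
def arrow : (Q.Arrow →₀ ℂ) →ₗ[ℂ] Q.CoPath :=
  Finsupp.linearCombination ℂ fun a => Q.path (.cons a (.vertex (Q.src a)))

/-- The comultiplication on paths, `Δ(x) = x ⊗ x` for a vertex and
`Δ(a p) = t(a) ⊗ a p + ∑ a p₁ ⊗ p₂` if `Δ(p) = ∑ p₁ ⊗ p₂`, so that
`Δ(aₙ ⋯ a₁) = ∑ᵢ aₙ ⋯ aᵢ₊₁ ⊗ aᵢ ⋯ a₁`. -/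
def comulPath : ∀ {y : G}, Q.PathTo y → Q.CoPath ⊗[ℂ] Q.CoPath
  | _, .vertex x => Q.vert x ⊗ₜ Q.vert x
  | _, .cons a p => Q.vert (Q.tgt a) ⊗ₜ Q.path (.cons a p) +
      (Q.cons (Q.arr a)).rTensor Q.CoPath (comulPath p)

/-- The counit on paths: `1` on vertices, `0` on paths of positive length. -/
def counitPath : ∀ {y : G}, Q.PathTo y → ℂ
  | _, .vertex _ => 1
  | _, .cons _ _ => 0

/-- The product `x q` of a vertex and a path: `x (b q') = (x · b) (x q')`. -/
def mulVertPath (x : G) : ∀ {z : G}, Q.PathTo z → Q.CoPath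
  | _, .vertex y => Q.vert (x * y)
  | _, .cons b q => Q.cons (Q.left x (Q.arr b)) (mulVertPath x q)

/-- Given `f = (p' * ·)`, the product `(a p') q`, by `(a p') y = (a · y) (p' y)` and
`(a p') (b q') = (a · t(b)) (p' (b q')) + (t(a) · b) ((a p') q')`. -/
def mulConsPath (a : Q.Arrow) (f : Q.CoPath →ₗ[ℂ] Q.CoPath) : ∀ {z : G}, Q.PathTo z → Q.CoPath
  | _, .vertex y => Q.cons (Q.right (.op y) (Q.arr a)) (f (Q.vert y))
  | _, .cons b q => Q.cons (Q.right (.op (Q.tgt b)) (Q.arr a)) (f (Q.path (.cons b q))) +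
      Q.cons (Q.left (Q.tgt a) (Q.arr b)) (mulConsPath a f q)

/-- Left multiplication by a path. -/
def mulPath : ∀ {y : G}, Q.PathTo y → Q.CoPath →ₗ[ℂ] Q.CoPath
  | _, .vertex x => Q.extend (Q.mulVertPath x)
  | _, .cons a p => Q.extend (Q.mulConsPath a (mulPath p))

/-- The multiplication of `kQᶜ`: the unique graded map of coalgebras `kQᶜ ⊗ kQᶜ → kQᶜ` that is
the multiplication of `G` on pairs of vertices and the bimodule action on pairs of a vertex and an
arrow. -/
def mulLin : Q.CoPath →ₗ[ℂ] Q.CoPath →ₗ[ℂ] Q.CoPath := Q.extend Q.mulPath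

instance : Mul Q.CoPath := ⟨fun h k => Q.mulLin h k⟩
instance : One Q.CoPath := ⟨Q.vert 1⟩

/-- The comultiplication. -/
def comulLin : Q.CoPath →ₗ[ℂ] Q.CoPath ⊗[ℂ] Q.CoPath := Q.extend Q.comulPath

/-- The counit. -/
def counitLin : Q.CoPath →ₗ[ℂ] ℂ := Q.extend Q.counitPath

variable {Q}

@[simp] theorem extend_path {N : Type*} [AddCommMonoid N] [Module ℂ N]
    (f : ∀ {y : G}, Q.PathTo y → N) {y : G} (p : Q.PathTo y) : Q.extend f (Q.path p) = f p := by
  simp [extend, path]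

theorem hom_ext {N : Type*} [AddCommMonoid N] [Module ℂ N] {f g : Q.CoPath →ₗ[ℂ] N}
    (h : ∀ y (p : Q.PathTo y), f (Q.path p) = g (Q.path p)) : f = g :=
  Q.pathBasis.ext fun p => h p.1 p.2

/-- Induction over `kQᶜ`. -/
theorem coPath_induction {P : Q.CoPath → Prop} (h : Q.CoPath) (h0 : P 0)
    (ha : ∀ x y, P x → P y → P (x + y)) (hs : ∀ (c : ℂ) x, P x → P (c • x))
    (hp : ∀ y (p : Q.PathTo y), P (Q.path p)) : P h := by
  have : h ∈ Submodule.span ℂ (Set.range Q.pathBasis) := by simp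
  induction this using Submodule.span_induction with
  | mem x hx => obtain ⟨p, rfl⟩ := hx; exact hp p.1 p.2
  | zero => exact h0
  | add x y _ _ hx hy => exact ha x y hx hy
  | smul c x _ hx => exact hs c x hx

theorem cons_path (a : Q.Arrow) (p : Q.PathTo (Q.src a)) :
    Q.cons (Q.arr a) (Q.path p) = Q.path (.cons a p) := by
  simp [cons, consPath]

theorem cons_path_of_ne {a : Q.Arrow} {y : G} {p : Q.PathTo y} (h : y ≠ Q.src a) :
    Q.cons (Q.arr a) (Q.path p) = 0 := by
  simp [cons, consPath, h]

theorem mul_def (h k : Q.CoPath) : h * k = Q.mulLin h k := rfl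

theorem vert_mul_vert (x y : G) : Q.vert x * Q.vert y = Q.vert (x * y) := by
  simp [mul_def, mulLin, vert, mulPath, mulVertPath]

theorem comul_vert (x : G) : Q.comulLin (Q.vert x) = Q.vert x ⊗ₜ Q.vert x := by
  simp [comulLin, vert, comulPath]

theorem counit_vert (x : G) : Q.counitLin (Q.vert x) = 1 := by
  simp [counitLin, vert, counitPath]

/-- The span of the paths ending at `y`. -/
def endsAt (Q : HopfBimoduleQuiver.{u, v} G) (y : G) : Submodule ℂ Q.CoPath :=
  Submodule.span ℂ (Set.range fun p : Q.PathTo y => Q.path p)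

/-- The span of the arrows from `x` to `y`. -/
abbrev arrows (Q : HopfBimoduleQuiver.{u, v} G) (x y : G) : Submodule ℂ (Q.Arrow →₀ ℂ) :=
  Finsupp.supported ℂ ℂ {b | Q.src b = x ∧ Q.tgt b = y}

theorem path_mem {y : G} (p : Q.PathTo y) : Q.path p ∈ Q.endsAt y :=
  Submodule.subset_span ⟨p, rfl⟩

theorem arr_mem (a : Q.Arrow) : Q.arr a ∈ Q.arrows (Q.src a) (Q.tgt a) :=
  Finsupp.single_mem_supported ℂ _ ⟨rfl, rfl⟩

theorem arrows_induction {x y : G} {P : (m : Q.Arrow →₀ ℂ) → m ∈ Q.arrows x y → Prop}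
    (h0 : P 0 (zero_mem _))
    (ha : ∀ m n hm hn, P m hm → P n hn → P (m + n) (add_mem hm hn))
    (hs : ∀ (c : ℂ) m hm, P m hm → P (c • m) (Submodule.smul_mem _ c hm))
    (hp : ∀ a (hx : Q.src a = x) (hy : Q.tgt a = y),
      P (Q.arr a) (Finsupp.single_mem_supported ℂ _ ⟨hx, hy⟩))
    {m : Q.Arrow →₀ ℂ} (hm : m ∈ Q.arrows x y) : P m hm := by
  have hm' := hm
  rw [arrows, Finsupp.supported_eq_span_single] at hm'
  have key : ∃ h, P m h := by
    clear hm
    induction hm' using Submodule.span_induction with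
    | mem m hm => obtain ⟨a, ⟨h1, h2⟩, rfl⟩ := hm; exact ⟨_, hp a h1 h2⟩
    | zero => exact ⟨_, h0⟩
    | add m n h1 h2 hm hn =>
      exact ⟨_, ha m n _ _ hm.2 hn.2⟩
    | smul c x h1 hx =>
      exact ⟨_, hs c x _ hx.2⟩
  exact key.2

theorem left_mem' {x y : G} {m : Q.Arrow →₀ ℂ} (hm : m ∈ Q.arrows x y) (g : G) :
    Q.left g m ∈ Q.arrows (g * x) (g * y) := by
  induction hm using arrows_induction with
  | h0 => simp
  | ha m n _ _ h1 h2 => rw [map_add]; exact add_mem h1 h2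
  | hs c m _ h => rw [map_smul]; exact Submodule.smul_mem _ _ h
  | hp a h1 h2 => subst h1 h2; exact Q.left_mem g a

theorem right_mem' {x y : G} {m : Q.Arrow →₀ ℂ} (hm : m ∈ Q.arrows x y) (g : G) :
    Q.right (.op g) m ∈ Q.arrows (x * g) (y * g) := by
  induction hm using arrows_induction with
  | h0 => simp
  | ha m n _ _ h1 h2 => rw [map_add]; exact add_mem h1 h2
  | hs c m _ h => rw [map_smul]; exact Submodule.smul_mem _ _ h
  | hp a h1 h2 => subst h1 h2; exact Q.right_mem g a

theorem cons_mem {x y : G} {m : Q.Arrow →₀ ℂ} (hm : m ∈ Q.arrows x y) (h : Q.CoPath) :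
    Q.cons m h ∈ Q.endsAt y := by
  induction hm using arrows_induction with
  | h0 => simp
  | ha m n _ _ h1 h2 => rw [map_add]; exact add_mem h1 h2
  | hs c m _ h => rw [map_smul]; exact Submodule.smul_mem _ _ h
  | hp a h1 h2 =>
    subst h1 h2
    induction h using coPath_induction with
    | h0 => simp
    | ha m n h1 h2 => rw [map_add]; exact add_mem h1 h2
    | hs c m h => rw [map_smul]; exact Submodule.smul_mem _ _ h
    | hp y p =>
      by_cases h : y = Q.src a
      · subst h; rw [cons_path]; exact path_mem _
      · rw [cons_path_of_ne h]; exact zero_mem _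

theorem cons_eq_zero {x y z : G} {m : Q.Arrow →₀ ℂ} (hm : m ∈ Q.arrows x y) {h : Q.CoPath}
    (hh : h ∈ Q.endsAt z) (hz : z ≠ x) : Q.cons m h = 0 := by
  induction hm using arrows_induction with
  | h0 => simp
  | ha m n _ _ h1 h2 => simp [h1, h2]
  | hs c m _ h => simp [h]
  | hp a h1 h2 =>
    subst h1 h2
    induction hh using Submodule.span_induction with
    | mem h hh => obtain ⟨p, rfl⟩ := hh; exact cons_path_of_ne hz
    | zero => simp
    | add x y _ _ hx hy => simp [hx, hy]
    | smul c x _ hx => simp [hx]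

theorem zero_mul' (h : Q.CoPath) : 0 * h = 0 := by simp [mul_def]
theorem mul_zero' (h : Q.CoPath) : h * 0 = 0 := by simp [mul_def]
theorem add_mul' (h k l : Q.CoPath) : (h + k) * l = h * l + k * l := by simp [mul_def]
theorem mul_add' (h k l : Q.CoPath) : h * (k + l) = h * k + h * l := by simp [mul_def]
theorem smul_mul' (c : ℂ) (h k : Q.CoPath) : (c • h) * k = c • (h * k) := by simp [mul_def]
theorem mul_smul' (c : ℂ) (h k : Q.CoPath) : h * (c • k) = c • (h * k) := by simp [mul_def]

theorem vert_mul_cons_path (x : G) (b : Q.Arrow) (q : Q.PathTo (Q.src b)) :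
    Q.vert x * Q.path (.cons b q) = Q.cons (Q.left x (Q.arr b)) (Q.vert x * Q.path q) := by
  simp [mul_def, mulLin, vert, mulPath, mulVertPath]

theorem cons_path_mul_vert (a : Q.Arrow) (p : Q.PathTo (Q.src a)) (y : G) :
    Q.path (.cons a p) * Q.vert y =
      Q.cons (Q.right (.op y) (Q.arr a)) (Q.path p * Q.vert y) := by
  simp [mul_def, mulLin, vert, mulPath, mulConsPath]

theorem cons_path_mul_cons_path (a : Q.Arrow) (p : Q.PathTo (Q.src a)) (b : Q.Arrow)
    (q : Q.PathTo (Q.src b)) : Q.path (.cons a p) * Q.path (.cons b q) =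
      Q.cons (Q.right (.op (Q.tgt b)) (Q.arr a)) (Q.path p * Q.path (.cons b q)) +
      Q.cons (Q.left (Q.tgt a) (Q.arr b)) (Q.path (.cons a p) * Q.path q) := by
  simp [mul_def, mulLin, mulPath, mulConsPath]

theorem path_mul_path_mem {y z : G} (p : Q.PathTo y) (q : Q.PathTo z) :
    Q.path p * Q.path q ∈ Q.endsAt (y * z) := by
  cases p with
  | vertex x =>
    cases q with
    | vertex y => exact (vert_mul_vert (Q := Q) _ _).symm ▸ path_mem _
    | cons b q => exact vert_mul_cons_path _ b q ▸ cons_mem (left_mem' (arr_mem b) _) _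
  | cons a p =>
    cases q with
    | vertex y => exact cons_path_mul_vert a p _ ▸ cons_mem (right_mem' (arr_mem a) _) _
    | cons b q =>
      rw [cons_path_mul_cons_path]
      exact add_mem (cons_mem (right_mem' (arr_mem a) _) _) (cons_mem (left_mem' (arr_mem b) _) _)

theorem mul_mem_endsAt {y z : G} {h k : Q.CoPath} (hh : h ∈ Q.endsAt y) (hk : k ∈ Q.endsAt z) :
    h * k ∈ Q.endsAt (y * z) := by
  induction hh using Submodule.span_induction with
  | mem h hh =>
    obtain ⟨p, rfl⟩ := hh
    induction hk using Submodule.span_induction with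
    | mem k hk => obtain ⟨q, rfl⟩ := hk; exact path_mul_path_mem p q
    | zero => simp [mul_zero']
    | add _ _ _ _ hx hy => rw [mul_add']; exact add_mem hx hy
    | smul c _ _ hx => rw [mul_smul']; exact Submodule.smul_mem _ _ hx
  | zero => simp [zero_mul']
  | add _ _ _ _ hx hy => rw [add_mul']; exact add_mem hx hy
  | smul c _ _ hx => rw [smul_mul']; exact Submodule.smul_mem _ _ hx

theorem vert_mem (x : G) : Q.vert x ∈ Q.endsAt x := path_mem _

theorem vert_mul_cons (x : G) (m : Q.Arrow →₀ ℂ) (h : Q.CoPath) :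
    Q.vert x * Q.cons m h = Q.cons (Q.left x m) (Q.vert x * h) := by
  induction m using Finsupp.induction_linear with
  | zero => simp [mul_zero']
  | add m n h1 h2 => simp [mul_add', h1, h2]
  | single b c =>
    rw [← Finsupp.smul_single_one b c]
    simp only [map_smul, LinearMap.smul_apply, mul_smul']
    congr 1
    induction h using coPath_induction with
    | h0 => simp [mul_zero']
    | ha m n h1 h2 => simp [mul_add', h1, h2]
    | hs c m h => simp [mul_smul', h]
    | hp y p =>
      by_cases h : y = Q.src b
      · subst h; rw [cons_path, vert_mul_cons_path]
      · rw [cons_path_of_ne h, mul_zero', cons_eq_zero (left_mem' (arr_mem b) x)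
          (mul_mem_endsAt (vert_mem x) (path_mem p)) (by simpa using h)]

theorem cons_mul_vert (m : Q.Arrow →₀ ℂ) (h : Q.CoPath) (x : G) :
    Q.cons m h * Q.vert x = Q.cons (Q.right (.op x) m) (h * Q.vert x) := by
  induction m using Finsupp.induction_linear with
  | zero => simp [zero_mul']
  | add m n h1 h2 => simp [add_mul', h1, h2]
  | single b c =>
    rw [← Finsupp.smul_single_one b c]
    simp only [map_smul, LinearMap.smul_apply, smul_mul']
    congr 1
    induction h using coPath_induction with
    | h0 => simp [zero_mul']
    | ha m n h1 h2 => simp [add_mul', h1, h2]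
    | hs c m h => simp [smul_mul', h]
    | hp y p =>
      by_cases h : y = Q.src b
      · subst h; rw [cons_path, cons_path_mul_vert]
      · rw [cons_path_of_ne h, zero_mul', cons_eq_zero (right_mem' (arr_mem b) x)
          (mul_mem_endsAt (path_mem p) (vert_mem x)) (by simpa using h)]

theorem cons_mul_cons {x y x' y' : G} {m n : Q.Arrow →₀ ℂ} (hm : m ∈ Q.arrows x y)
    (hn : n ∈ Q.arrows x' y') (h k : Q.CoPath) : Q.cons m h * Q.cons n k =
      Q.cons (Q.right (.op y') m) (h * Q.cons n k) + Q.cons (Q.left y n) (Q.cons m h * k) := by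
  induction hm using arrows_induction with
  | h0 => simp [zero_mul']
  | ha m n _ _ h1 h2 => simp only [map_add, LinearMap.add_apply, add_mul', h1, h2]; abel
  | hs c m _ h => simp [smul_mul', h]
  | hp a h1 h2 =>
  subst h1 h2
  induction hn using arrows_induction with
  | h0 => simp [mul_zero']
  | ha m n _ _ h1 h2 => simp only [map_add, LinearMap.add_apply, mul_add', h1, h2]; abel
  | hs c m _ h => simp [mul_smul', h]
  | hp b h1 h2 =>
  subst h1 h2
  induction h using coPath_induction with
  | h0 => simp [zero_mul']
  | ha m n h1 h2 => simp only [map_add, add_mul', h1, h2]; abel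
  | hs c m h => simp [smul_mul', h]
  | hp y p =>
  induction k using coPath_induction with
  | h0 => simp [mul_zero']
  | ha m n h1 h2 => simp only [map_add, mul_add', h1, h2]; abel
  | hs c m h => simp [mul_smul', h]
  | hp z q =>
  by_cases hy : y = Q.src a
  · subst hy
    by_cases hz : z = Q.src b
    · subst hz; rw [cons_path, cons_path, cons_path_mul_cons_path]
    · rw [cons_path_of_ne hz, cons_path, mul_zero', mul_zero', cons_eq_zero
        (left_mem' (arr_mem b) _) (mul_mem_endsAt (path_mem _) (path_mem q)) (by simpa using hz)]
      simp
  · rw [cons_path_of_ne hy, zero_mul', zero_mul', cons_eq_zero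
        (right_mem' (arr_mem a) _) (mul_mem_endsAt (path_mem _) (cons_mem (arr_mem b) _))
        (by simpa using hy)]
    simp

theorem one_mul' (h : Q.CoPath) : 1 * h = h := by
  change Q.vert 1 * h = h
  induction h using coPath_induction with
  | h0 => exact mul_zero' _
  | ha m n h1 h2 => rw [mul_add', h1, h2]
  | hs c m h => rw [mul_smul', h]
  | hp y p =>
    induction p with
    | vertex x => exact (vert_mul_vert 1 x).trans (by rw [one_mul]; rfl)
    | cons a p ih => rw [← cons_path, vert_mul_cons, ih]; simp

theorem mul_one' (h : Q.CoPath) : h * 1 = h := by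
  change h * Q.vert 1 = h
  induction h using coPath_induction with
  | h0 => exact zero_mul' _
  | ha m n h1 h2 => rw [add_mul', h1, h2]
  | hs c m h => rw [smul_mul', h]
  | hp y p =>
    induction p with
    | vertex x => exact (vert_mul_vert x 1).trans (by rw [mul_one]; rfl)
    | cons a p ih => rw [← cons_path, cons_mul_vert, ih]; simp

theorem left_mul' (x y : G) (m : Q.Arrow →₀ ℂ) : Q.left x (Q.left y m) = Q.left (x * y) m := by
  simp
theorem right_mul' (x y : G) (m : Q.Arrow →₀ ℂ) :
    Q.right (.op y) (Q.right (.op x) m) = Q.right (.op (x * y)) m := by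
  simp

theorem assoc_vcc (x : G) (b c : Q.Arrow) {q r : Q.CoPath}
    (h1 : Q.vert x * q * Q.cons (Q.arr c) r = Q.vert x * (q * Q.cons (Q.arr c) r))
    (h2 : Q.vert x * Q.cons (Q.arr b) q * r = Q.vert x * (Q.cons (Q.arr b) q * r)) :
    Q.vert x * Q.cons (Q.arr b) q * Q.cons (Q.arr c) r =
      Q.vert x * (Q.cons (Q.arr b) q * Q.cons (Q.arr c) r) := by
  rw [cons_mul_cons (arr_mem b) (arr_mem c), mul_add', vert_mul_cons, vert_mul_cons, vert_mul_cons,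
    cons_mul_cons (left_mem' (arr_mem b) x) (arr_mem c), h1, ← vert_mul_cons, h2, Q.left_right,
    left_mul']

theorem path_mul_assoc {y z w : G} (p : Q.PathTo y) (q : Q.PathTo z) (r : Q.PathTo w) :
    Q.path p * Q.path q * Q.path r = Q.path p * (Q.path q * Q.path r) := by
  have key := @left_mul' G _ Q
  have key2 := @right_mul' G _ Q
  induction p generalizing z w with
  | vertex x =>
    change Q.vert x * _ * _ = Q.vert x * _
    induction q generalizing w with
    | vertex y =>
      change _ * Q.vert y * _ = _ * (Q.vert y * _)
      induction r with
      | vertex z =>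
        change _ * _ * Q.vert z = _ * (_ * Q.vert z)
        simp only [vert_mul_vert, mul_assoc]
      | cons c r ih =>
        simp only [← cons_path, vert_mul_vert, vert_mul_cons, key] at ih ⊢
        rw [ih]
    | cons b q ihq =>
      induction r with
      | vertex z =>
        change _ * _ * Q.vert z = _ * (_ * Q.vert z)
        rw [← cons_path, vert_mul_cons, cons_mul_vert, cons_mul_vert, vert_mul_cons, ← Q.left_right]
        congr 1
        exact ihq (.vertex z)
      | cons c r ih =>
        have h1 := ihq (.cons c r)
        rw [← cons_path c] at h1
        rw [← cons_path b] at ih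
        rw [← cons_path b, ← cons_path c]
        exact assoc_vcc x b c h1 ih
  | cons a p ihp =>
    induction q generalizing w with
    | vertex y =>
      change _ * Q.vert y * _ = _ * (Q.vert y * _)
      induction r with
      | vertex z =>
        change _ * _ * Q.vert z = _ * (_ * Q.vert z)
        have := ihp (.vertex y) (.vertex z)
        change _ * Q.vert y * Q.vert z = _ * (Q.vert y * Q.vert z) at this
        simp only [← cons_path, vert_mul_vert, cons_mul_vert, key2] at this ⊢
        rw [this]
      | cons c r ih =>
        have h1 := ihp (.vertex y) (.cons c r)
        change _ * Q.vert y * _ = _ * (Q.vert y * _) at h1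
        have h2 := ih
        clear ih ihp
        rw [← cons_path c r, vert_mul_cons] at h1
        rw [← cons_path a p, cons_mul_vert] at h2
        rw [← cons_path a p, ← cons_path c r, vert_mul_cons, cons_mul_vert,
          cons_mul_cons (right_mem' (arr_mem a) y) (arr_mem c), h1, h2,
          cons_mul_cons (arr_mem a) (left_mem' (arr_mem c) y), key, key2]
    | cons b q ihq =>
      induction r with
      | vertex z =>
        have h1 := ihq (.vertex z)
        have h2 := ihp (.cons b q) (.vertex z)
        change _ * _ * Q.vert z = _ * (_ * Q.vert z) at h1 h2 ⊢
        clear ihp ihq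
        rw [← cons_path a] at h1 ⊢
        rw [← cons_path b] at h2 ⊢
        rw [cons_mul_vert] at h2 ⊢
        rw [cons_mul_cons (arr_mem a) (arr_mem b), add_mul', cons_mul_vert, cons_mul_vert,
          h1, h2, cons_mul_cons (arr_mem a) (right_mem' (arr_mem b) z), key2, Q.left_right]
      | cons c r ih =>
        have h1 := ihq (.cons c r)
        have h2 := ihp (.cons b q) (.cons c r)
        clear ihp ihq
        rw [← cons_path a, ← cons_path c] at h1
        rw [← cons_path b, ← cons_path c] at h2
        rw [← cons_path a, ← cons_path b] at ih
        rw [← cons_path a, ← cons_path b, ← cons_path c]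
        have ha := arr_mem a
        have hb := arr_mem b
        have hc := arr_mem c
        rw [cons_mul_cons ha hb, add_mul', cons_mul_cons (right_mem' ha _) hc,
          cons_mul_cons (left_mem' hb _) hc, h1, h2, cons_mul_cons hb hc, mul_add', mul_add',
          cons_mul_cons ha (right_mem' hb _), cons_mul_cons ha (left_mem' hc _), ← ih,
          cons_mul_cons ha hb, add_mul']
        simp only [map_add, key, key2, Q.left_right]
        abel

theorem mul_assoc' (h k l : Q.CoPath) : h * k * l = h * (k * l) := by
  induction h using coPath_induction with
  | h0 => simp [zero_mul']
  | ha m n h1 h2 => simp only [add_mul', h1, h2]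
  | hs c m h => simp only [smul_mul', h]
  | hp y p =>
  induction k using coPath_induction with
  | h0 => simp [zero_mul', mul_zero']
  | ha m n h1 h2 => simp only [add_mul', mul_add', h1, h2]
  | hs c m h => simp only [smul_mul', mul_smul', h]
  | hp z q =>
  induction l using coPath_induction with
  | h0 => simp [mul_zero']
  | ha m n h1 h2 => simp only [mul_add', h1, h2]
  | hs c m h => simp only [mul_smul', h]
  | hp z q => exact path_mul_assoc _ _ _

instance : Ring Q.CoPath :=
  { (inferInstance : AddCommGroup Q.CoPath) with
    mul := (· * ·)
    one := 1
    left_distrib := mul_add'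
    right_distrib := add_mul'
    zero_mul := zero_mul'
    mul_zero := mul_zero'
    mul_assoc := mul_assoc'
    one_mul := one_mul'
    mul_one := mul_one' }

instance : Algebra ℂ Q.CoPath := Algebra.ofModule smul_mul' mul_smul'

theorem comul_path_mem {y : G} (p : Q.PathTo y) : Q.comulLin (Q.path p) ∈
    LinearMap.range ((Q.endsAt y).subtype.rTensor Q.CoPath) := by
  induction p with
  | vertex x => exact ⟨⟨_, vert_mem x⟩ ⊗ₜ Q.vert x, (comul_vert x).symm⟩
  | cons a p ih =>
    simp only [comulLin, extend_path, comulPath]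
    refine add_mem ⟨⟨_, path_mem _⟩ ⊗ₜ _, rfl⟩ ?_
    generalize Q.comulPath p = t
    induction t with
    | zero => simp
    | add s t hs ht => rw [map_add]; exact add_mem hs ht
    | tmul s t => exact ⟨⟨_, cons_mem (arr_mem a) s⟩ ⊗ₜ t, rfl⟩

theorem comul_cons_arr (a : Q.Arrow) (h : Q.CoPath) :
    Q.comulLin (Q.cons (Q.arr a) h) = Q.vert (Q.tgt a) ⊗ₜ Q.cons (Q.arr a) h +
      (Q.cons (Q.arr a)).rTensor Q.CoPath (Q.comulLin h) := by
  induction h using coPath_induction with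
  | h0 => simp
  | ha m n h1 h2 =>
    simp only [map_add, h1, h2, TensorProduct.tmul_add]
    abel
  | hs c m h => simp [h]
  | hp y p =>
    by_cases hy : y = Q.src a
    · subst hy
      rw [cons_path]
      simp [comulLin, comulPath]
    · rw [cons_path_of_ne hy]
      obtain ⟨t, ht⟩ := comul_path_mem p
      have h0 : Q.cons (Q.arr a) ∘ₗ (Q.endsAt y).subtype = 0 := by
        ext s
        exact cons_eq_zero (arr_mem a) s.2 hy
      rw [← ht, ← LinearMap.comp_apply, ← LinearMap.rTensor_comp, h0]
      simp

theorem comul_cons {x y : G} {m : Q.Arrow →₀ ℂ} (hm : m ∈ Q.arrows x y) (h : Q.CoPath) :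
    Q.comulLin (Q.cons m h) = Q.vert y ⊗ₜ Q.cons m h +
      (Q.cons m).rTensor Q.CoPath (Q.comulLin h) := by
  induction hm using arrows_induction with
  | h0 => simp
  | ha m n _ _ h1 h2 =>
    simp only [map_add, LinearMap.add_apply, h1, h2, TensorProduct.tmul_add, LinearMap.rTensor_add]
    abel
  | hs c m _ h => simp [h, LinearMap.rTensor_smul]
  | hp a h1 h2 => subst h1 h2; exact comul_cons_arr a h

theorem counit_cons (m : Q.Arrow →₀ ℂ) (h : Q.CoPath) : Q.counitLin (Q.cons m h) = 0 := by
  induction m using Finsupp.induction_linear with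
  | zero => simp
  | add m n h1 h2 => simp [h1, h2]
  | single a c =>
    rw [← Finsupp.smul_single_one a c]
    simp only [map_smul, LinearMap.smul_apply]
    induction h using coPath_induction with
    | h0 => simp
    | ha m n h1 h2 => simpa [mul_add, h1, h2] using congr($h1 + $h2)
    | hs d m h => rw [map_smul, map_smul, smul_comm, h, smul_zero]
    | hp y p =>
      by_cases hy : y = Q.src a
      · subst hy
        rw [cons_path]
        simp [counitLin, counitPath]
      · simp [cons_path_of_ne hy]

theorem rTensor_counit_comul (h : Q.CoPath) :
    Q.counitLin.rTensor Q.CoPath (Q.comulLin h) = 1 ⊗ₜ h := by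
  induction h using coPath_induction with
  | h0 => simp
  | ha m n h1 h2 => simp [h1, h2, TensorProduct.tmul_add]
  | hs c m h => simp [h]
  | hp y p =>
    induction p with
    | vertex x =>
      change Q.counitLin.rTensor Q.CoPath (Q.comulLin (Q.vert x)) = 1 ⊗ₜ Q.vert x
      simp [comul_vert, counit_vert]
    | cons a p ih =>
      have h0 : Q.counitLin ∘ₗ Q.cons (Q.arr a) = 0 := by
        ext h; exact counit_cons _ h
      rw [← cons_path, comul_cons_arr, map_add, ← LinearMap.comp_apply, ← LinearMap.rTensor_comp,
        h0]
      simp [counit_vert]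

theorem lTensor_counit_comul (h : Q.CoPath) :
    Q.counitLin.lTensor Q.CoPath (Q.comulLin h) = h ⊗ₜ 1 := by
  induction h using coPath_induction with
  | h0 => simp
  | ha m n h1 h2 => simp [h1, h2, TensorProduct.add_tmul]
  | hs c m h => simp [h, TensorProduct.smul_tmul']
  | hp y p =>
    induction p with
    | vertex x =>
      change Q.counitLin.lTensor Q.CoPath (Q.comulLin (Q.vert x)) = Q.vert x ⊗ₜ 1
      simp [comul_vert, counit_vert]
    | cons a p ih =>
      rw [← cons_path, comul_cons_arr, map_add, ← LinearMap.comp_apply, LinearMap.lTensor_comp_rTensor,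
        ← LinearMap.rTensor_comp_lTensor, LinearMap.comp_apply, ih]
      simp [counit_cons]

theorem comul_coassoc : (TensorProduct.assoc ℂ Q.CoPath Q.CoPath Q.CoPath).toLinearMap ∘ₗ
    Q.comulLin.rTensor Q.CoPath ∘ₗ Q.comulLin = Q.comulLin.lTensor Q.CoPath ∘ₗ Q.comulLin := by
  refine hom_ext fun y p => ?_
  simp only [LinearMap.comp_apply]
  have hα : ∀ a b c : Q.CoPath, (TensorProduct.assoc ℂ Q.CoPath Q.CoPath Q.CoPath).toLinearMap
      ((a ⊗ₜ b) ⊗ₜ c) = a ⊗ₜ (b ⊗ₜ c) := fun _ _ _ => rfl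
  generalize (TensorProduct.assoc ℂ Q.CoPath Q.CoPath Q.CoPath).toLinearMap = α at hα ⊢
  · induction p with
    | vertex x =>
      change α (Q.comulLin.rTensor Q.CoPath (Q.comulLin (Q.vert x))) =
        Q.comulLin.lTensor Q.CoPath (Q.comulLin (Q.vert x))
      simp [comul_vert, hα]
    | cons a p ih =>
      rw [← cons_path, comul_cons_arr, map_add, map_add, map_add]
      have h1 : (Q.comulLin.lTensor Q.CoPath) ((Q.cons (Q.arr a)).rTensor Q.CoPath
          (Q.comulLin (Q.path p))) = (Q.cons (Q.arr a)).rTensor _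
            (Q.comulLin.lTensor Q.CoPath (Q.comulLin (Q.path p))) := by
        rw [← LinearMap.comp_apply, LinearMap.lTensor_comp_rTensor,
          ← LinearMap.rTensor_comp_lTensor, LinearMap.comp_apply]
      rw [h1, ← ih]
      have h2 : ∀ t : Q.CoPath ⊗[ℂ] Q.CoPath, α (Q.comulLin.rTensor Q.CoPath ((Q.cons (Q.arr a)).rTensor Q.CoPath t)) =
          Q.vert (Q.tgt a) ⊗ₜ ((Q.cons (Q.arr a)).rTensor Q.CoPath t) +
          (Q.cons (Q.arr a)).rTensor _ (α (Q.comulLin.rTensor Q.CoPath t)) := by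
        intro t
        induction t with
        | zero => simp
        | add s t hs ht => simp only [map_add, hs, ht, TensorProduct.tmul_add]; abel
        | tmul s t =>
          simp only [LinearMap.rTensor_tmul, comul_cons_arr, TensorProduct.add_tmul, map_add,
            hα]
          congr 1
          generalize Q.comulLin s = u
          induction u with
          | zero => simp
          | add s t hs ht => simp only [map_add, hs, ht, TensorProduct.add_tmul]
          | tmul s t => simp [hα]
      rw [h2]
      simp only [LinearMap.rTensor_tmul, LinearMap.lTensor_tmul, comul_vert,
        hα, comul_cons_arr, TensorProduct.tmul_add]
      abel

instance : Coalgebra ℂ Q.CoPath where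
  comul := Q.comulLin
  counit := Q.counitLin
  coassoc := comul_coassoc
  rTensor_counit_comp_comul := LinearMap.ext rTensor_counit_comul
  lTensor_counit_comp_comul := LinearMap.ext lTensor_counit_comul

theorem rTensor_mul_rTensor {x y x' y' : G} {m n : Q.Arrow →₀ ℂ} (hm : m ∈ Q.arrows x y)
    (hn : n ∈ Q.arrows x' y') (s t : Q.CoPath ⊗[ℂ] Q.CoPath) :
    (Q.cons m).rTensor Q.CoPath s * (Q.cons n).rTensor Q.CoPath t =
      (Q.cons (Q.right (.op y') m)).rTensor Q.CoPath (s * (Q.cons n).rTensor Q.CoPath t) +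
      (Q.cons (Q.left y n)).rTensor Q.CoPath ((Q.cons m).rTensor Q.CoPath s * t) := by
  induction s with
  | zero => simp
  | add s s' hs hs' => simp only [map_add, add_mul, hs, hs']; abel
  | tmul s s' =>
    induction t with
    | zero => simp
    | add t t' ht ht' => simp only [map_add, mul_add, ht, ht']; abel
    | tmul t t' =>
      simp only [LinearMap.rTensor_tmul, Algebra.TensorProduct.tmul_mul_tmul,
        cons_mul_cons hm hn, TensorProduct.add_tmul]

theorem tmul_mul_rTensor (x : G) (k : Q.CoPath) (m : Q.Arrow →₀ ℂ) (t : Q.CoPath ⊗[ℂ] Q.CoPath) :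
    (Q.vert x ⊗ₜ k) * (Q.cons m).rTensor Q.CoPath t =
      (Q.cons (Q.left x m)).rTensor Q.CoPath ((Q.vert x ⊗ₜ k) * t) := by
  induction t with
  | zero => simp
  | add s s' hs hs' => simp only [map_add, mul_add, hs, hs']
  | tmul s s' => simp [vert_mul_cons]

theorem rTensor_mul_tmul (x : G) (k : Q.CoPath) (m : Q.Arrow →₀ ℂ) (t : Q.CoPath ⊗[ℂ] Q.CoPath) :
    (Q.cons m).rTensor Q.CoPath t * (Q.vert x ⊗ₜ k) =
      (Q.cons (Q.right (.op x) m)).rTensor Q.CoPath (t * (Q.vert x ⊗ₜ k)) := by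
  induction t with
  | zero => simp
  | add s s' hs hs' => simp only [map_add, add_mul, hs, hs']
  | tmul s s' => simp [cons_mul_vert]

theorem comul_path_mul_path {y z : G} (p : Q.PathTo y) (q : Q.PathTo z) :
    Q.comulLin (Q.path p * Q.path q) = Q.comulLin (Q.path p) * Q.comulLin (Q.path q) := by
  induction p generalizing z with
  | vertex x =>
    change Q.comulLin (Q.vert x * _) = Q.comulLin (Q.vert x) * _
    induction q with
    | vertex y =>
      change Q.comulLin (_ * Q.vert y) = _ * Q.comulLin (Q.vert y)
      simp [vert_mul_vert, comul_vert]
    | cons b q ih =>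
      rw [← cons_path, vert_mul_cons, comul_cons (left_mem' (arr_mem b) x), ih, comul_vert,
        comul_cons_arr, mul_add, tmul_mul_rTensor, Algebra.TensorProduct.tmul_mul_tmul,
        vert_mul_vert, vert_mul_cons]
  | cons a p ihp =>
    induction q with
    | vertex y =>
      have h1 := ihp (.vertex y)
      change Q.comulLin (_ * Q.vert y) = _ * Q.comulLin (Q.vert y) at h1 ⊢
      rw [← cons_path, cons_mul_vert, comul_cons (right_mem' (arr_mem a) y), h1, comul_vert,
        comul_cons_arr, add_mul, rTensor_mul_tmul, Algebra.TensorProduct.tmul_mul_tmul,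
        vert_mul_vert, cons_mul_vert]
    | cons b q ih =>
      have h1 := ihp (.cons b q)
      clear ihp
      have ha := arr_mem a
      have hb := arr_mem b
      rw [← cons_path b] at h1
      rw [← cons_path a] at ih
      rw [← cons_path a, ← cons_path b, cons_mul_cons ha hb, map_add,
        comul_cons (right_mem' ha _), comul_cons (left_mem' hb _), h1, ih,
        comul_cons_arr, comul_cons_arr, mul_add, add_mul, add_mul, mul_add, mul_add,
        rTensor_mul_rTensor ha hb, tmul_mul_rTensor, rTensor_mul_tmul,
        Algebra.TensorProduct.tmul_mul_tmul, vert_mul_vert, cons_mul_cons ha hb,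
        TensorProduct.tmul_add, map_add, map_add]
      abel

theorem counit_path_mul_path {y z : G} (p : Q.PathTo y) (q : Q.PathTo z) :
    Q.counitLin (Q.path p * Q.path q) = Q.counitLin (Q.path p) * Q.counitLin (Q.path q) := by
  cases p with
  | vertex x =>
    change Q.counitLin (Q.vert _ * _) = Q.counitLin (Q.vert _) * _
    cases q with
    | vertex y =>
      change Q.counitLin (_ * Q.vert _) = _ * Q.counitLin (Q.vert _)
      simp [vert_mul_vert, counit_vert]
    | cons b q => rw [← cons_path, vert_mul_cons, counit_cons, counit_cons, mul_zero]
  | cons a p =>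
    cases q with
    | vertex y =>
      change Q.counitLin (_ * Q.vert _) = _ * Q.counitLin (Q.vert _)
      rw [← cons_path, cons_mul_vert, counit_cons, counit_cons, zero_mul]
    | cons b q =>
      rw [← cons_path, ← cons_path, cons_mul_cons (arr_mem a) (arr_mem b), map_add, counit_cons,
        counit_cons, counit_cons, add_zero, zero_mul]

/-- Two bilinear maps that agree on paths are equal. -/
theorem bilin_ext {N : Type*} [AddCommMonoid N] [Module ℂ N] {f g : Q.CoPath →ₗ[ℂ] Q.CoPath →ₗ[ℂ] N}
    (h : ∀ y z (p : Q.PathTo y) (q : Q.PathTo z),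
      f (Q.path p) (Q.path q) = g (Q.path p) (Q.path q)) : f = g :=
  hom_ext fun y p => hom_ext fun z q => h y z p q

instance : Bialgebra ℂ Q.CoPath where
  counit_one := counit_vert 1
  comul_one := comul_vert 1
  mul_compr₂_counit := bilin_ext fun _ _ p q => counit_path_mul_path p q
  mul_compr₂_comul := bilin_ext fun _ _ p q => comul_path_mul_path p q

section Antipode

variable (f : Q.CoPath →ₗ[ℂ] Q.CoPath) (σ : G → G)

/-- If `f` maps each vertex `x` to the vertex `σ x`, it has a right convolution inverse `g`;
this is `(id ⊗ g) Δ(p)`, by recursion on the path `p`. -/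
def convInvAux : ∀ {y : G}, Q.PathTo y → Q.CoPath ⊗[ℂ] Q.CoPath
  | _, .vertex x => Q.vert x ⊗ₜ Q.vert (σ x)⁻¹
  | _, .cons a p =>
      let w := (Q.cons (Q.arr a)).rTensor Q.CoPath (convInvAux p)
      w - Q.vert (Q.tgt a) ⊗ₜ
        (Q.vert (σ (Q.tgt a))⁻¹ * LinearMap.mul' ℂ Q.CoPath (f.rTensor Q.CoPath w))

/-- The right convolution inverse on paths. -/
def convInvPath : ∀ {y : G}, Q.PathTo y → Q.CoPath
  | _, .vertex x => Q.vert (σ x)⁻¹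
  | _, .cons a p => - (Q.vert (σ (Q.tgt a))⁻¹ * LinearMap.mul' ℂ Q.CoPath
      (f.rTensor Q.CoPath ((Q.cons (Q.arr a)).rTensor Q.CoPath (convInvAux f σ p))))

/-- The right convolution inverse. -/
def convInv : Q.CoPath →ₗ[ℂ] Q.CoPath := Q.extend (convInvPath f σ)

theorem convInvAux_eq {y : G} (p : Q.PathTo y) :
    (convInv f σ).lTensor Q.CoPath (Q.comulLin (Q.path p)) = convInvAux f σ p := by
  induction p with
  | vertex x =>
    change (convInv f σ).lTensor Q.CoPath (Q.comulLin (Q.vert x)) = _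
    rw [comul_vert]
    simp [convInv, convInvAux, vert, convInvPath]
  | cons a p ih =>
    rw [← cons_path, comul_cons_arr, map_add,
      ← LinearMap.comp_apply (LinearMap.lTensor _ _) (LinearMap.rTensor _ _),
      LinearMap.lTensor_comp_rTensor, ← LinearMap.rTensor_comp_lTensor,
      LinearMap.comp_apply (LinearMap.rTensor _ _), ih, cons_path]
    simp [convInv, convInvAux, convInvPath, TensorProduct.tmul_neg, sub_eq_add_neg, add_comm]

theorem conv_convInv (hf : ∀ x, f (Q.vert x) = Q.vert (σ x)) :
    WithConv.toConv f * WithConv.toConv (convInv f σ) = 1 := by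
  have key : LinearMap.mul' ℂ Q.CoPath ∘ₗ TensorProduct.map f (convInv f σ) ∘ₗ Q.comulLin =
      Algebra.linearMap ℂ Q.CoPath ∘ₗ Q.counitLin := by
    refine hom_ext fun y p => ?_
    have h1 : TensorProduct.map f (convInv f σ) =
        f.rTensor Q.CoPath ∘ₗ (convInv f σ).lTensor Q.CoPath := by
      rw [LinearMap.rTensor_comp_lTensor]
    simp only [h1, LinearMap.comp_apply, convInvAux_eq]
    cases p with
    | vertex x =>
      change _ = Algebra.linearMap ℂ Q.CoPath (Q.counitLin (Q.vert _))
      simp only [convInvAux, LinearMap.rTensor_tmul, hf, LinearMap.mul'_apply, vert_mul_vert,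
        counit_vert, mul_inv_cancel, Algebra.linearMap_apply, map_one]
      rfl
    | cons a p =>
      rw [← cons_path a p, counit_cons, map_zero]
      simp only [convInvAux, map_sub, LinearMap.rTensor_tmul, hf, LinearMap.mul'_apply]
      rw [← mul_assoc, vert_mul_vert, mul_inv_cancel]
      exact (congrArg _ (one_mul _)).trans (sub_self _)
  exact WithConv.ext key

theorem convInv_vert (x : G) : convInv f σ (Q.vert x) = Q.vert (σ x)⁻¹ := by
  simp [convInv, vert, convInvPath]

end Antipode

variable (Q) in
/-- The antipode, determined recursively by `S(x) = x⁻¹` on vertices and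
`S(a p) = - t(a)⁻¹ ∑ (a p₁) S(p₂)` if `Δ(p) = ∑ p₁ ⊗ p₂`. -/
def antipodeLin : Q.CoPath →ₗ[ℂ] Q.CoPath := convInv LinearMap.id id

theorem id_conv_antipode : WithConv.toConv LinearMap.id * WithConv.toConv Q.antipodeLin = 1 :=
  conv_convInv _ _ fun _ => rfl

theorem antipode_conv_id : WithConv.toConv Q.antipodeLin * WithConv.toConv LinearMap.id = 1 := by
  have h1 := id_conv_antipode (Q := Q)
  have h2 := conv_convInv Q.antipodeLin (fun x => x⁻¹) (convInv_vert _ _)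
  rwa [← left_inv_eq_right_inv h1 h2] at h2

instance : HopfAlgebra ℂ Q.CoPath :=
  HopfAlgebra.ofConvInverse Q.antipodeLin antipode_conv_id id_conv_antipode

theorem antipode_vert (x : G) : HopfAlgebra.antipode ℂ (Q.vert x) = Q.vert x⁻¹ :=
  convInv_vert _ _ x

theorem comul_arrow (a : Q.Arrow) : Coalgebra.comul (R := ℂ) (Q.arrow (Q.arr a)) =
    Q.vert (Q.tgt a) ⊗ₜ Q.arrow (Q.arr a) + Q.arrow (Q.arr a) ⊗ₜ Q.vert (Q.src a) := by
  have h : Q.arrow (Q.arr a) = Q.cons (Q.arr a) (Q.vert (Q.src a)) := by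
    simp [arrow, vert, cons_path]
  rw [h]
  refine (comul_cons_arr a _).trans ?_
  rw [comul_vert]
  rfl

theorem antipode_arrow (a : Q.Arrow) : HopfAlgebra.antipode ℂ (Q.arrow (Q.arr a)) =
    - (Q.vert (Q.tgt a)⁻¹ * Q.arrow (Q.arr a) * Q.vert (Q.src a)⁻¹) := by
  have h : Q.arrow (Q.arr a) = Q.cons (Q.arr a) (Q.vert (Q.src a)) := by
    simp [arrow, vert, cons_path]
  have h' : Q.arrow (Q.arr a) = Q.path (.cons a (.vertex (Q.src a))) := by
    simp [arrow]
  refine Eq.trans (congrArg _ h') ?_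
  change convInv _ _ _ = _
  simp [convInv, convInvPath, convInvAux, h, mul_assoc]

variable (Q) in
/-- The subalgebra `kG[kQ₁ᶜ]` of `kQᶜ` generated by the vertices and the arrows. It is a Hopf
subalgebra. -/
def oneType : HopfSubalgebra ℂ Q.CoPath where
  toSubalgebra := Algebra.adjoin ℂ (Set.range Q.vert ∪ Set.range fun a => Q.arrow (Q.arr a))
  comul_mem' := by
    intro x hx
    set A := Algebra.adjoin ℂ (Set.range Q.vert ∪ Set.range fun a => Q.arrow (Q.arr a)) with hA
    have hv : ∀ x, Q.vert x ∈ A := fun x => Algebra.subset_adjoin (Or.inl ⟨x, rfl⟩)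
    have ha : ∀ a, Q.arrow (Q.arr a) ∈ A := fun a => Algebra.subset_adjoin (Or.inr ⟨a, rfl⟩)
    suffices h : A ≤ (Algebra.TensorProduct.map A.val A.val).range.comap
        (Bialgebra.comulAlgHom ℂ Q.CoPath) from h hx
    refine Algebra.adjoin_le ?_
    rintro _ (⟨x, rfl⟩ | ⟨a, rfl⟩)
    · exact ⟨⟨_, hv x⟩ ⊗ₜ ⟨_, hv x⟩, (comul_vert x).symm⟩
    · exact ⟨⟨_, hv (Q.tgt a)⟩ ⊗ₜ ⟨_, ha a⟩ + ⟨_, ha a⟩ ⊗ₜ ⟨_, hv (Q.src a)⟩, (comul_arrow a).symm⟩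
  antipode_mem' := by
    intro x hx
    set A := Algebra.adjoin ℂ (Set.range Q.vert ∪ Set.range fun a => Q.arrow (Q.arr a)) with hA
    have hv : ∀ x, Q.vert x ∈ A := fun x => Algebra.subset_adjoin (Or.inl ⟨x, rfl⟩)
    have ha : ∀ a, Q.arrow (Q.arr a) ∈ A := fun a => Algebra.subset_adjoin (Or.inr ⟨a, rfl⟩)
    change x ∈ A at hx
    change _ ∈ A
    induction hx using Algebra.adjoin_induction with
    | mem x hx =>
      obtain ⟨x, rfl⟩ | ⟨a, rfl⟩ := hx
      · exact antipode_vert (Q := Q) x ▸ hv _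
      · exact antipode_arrow (Q := Q) a ▸ neg_mem (mul_mem (mul_mem (hv _) (ha _)) (hv _))
    | algebraMap r =>
      rw [Algebra.algebraMap_eq_smul_one, map_smul, HopfAlgebra.antipode_one]
      exact Subalgebra.smul_mem _ (one_mem _) _
    | add x y _ _ hx hy => rw [map_add]; exact add_mem hx hy
    | mul x y _ _ hx hy => rw [HopfAlgebra.antipode_mul_antidistrib]; exact mul_mem hy hx

end HopfBimoduleQuiver

/-! ### Yetter-Drinfeld modules and Nichols algebras -/

section Nichols

/-- A (left-left) Yetter-Drinfeld module structure over the group algebra `kG` on `V`. -/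
structure YetterDrinfeld (G : Type u) [Group G] (V : Type v) [AddCommGroup V] [Module ℂ V] where
  action : Representation ℂ G V
  coaction : V →ₗ[ℂ] MonoidAlgebra ℂ G ⊗[ℂ] V
  counit_coaction : (Coalgebra.counit (R := ℂ) (A := MonoidAlgebra ℂ G)).rTensor V ∘ₗ coaction =
    TensorProduct.mk ℂ ℂ V 1
  coassoc : (TensorProduct.assoc ℂ (MonoidAlgebra ℂ G) (MonoidAlgebra ℂ G) V).toLinearMap ∘ₗ
    (Coalgebra.comul (R := ℂ) (A := MonoidAlgebra ℂ G)).rTensor V ∘ₗ coaction =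
      coaction.lTensor (MonoidAlgebra ℂ G) ∘ₗ coaction
  /-- `δ(g · v) = g v₍₋₁₎ g⁻¹ ⊗ g · v₍₀₎`. -/
  coaction_action : ∀ g v, coaction (action g v) =
    TensorProduct.map (LinearMap.mulLeftRight ℂ
      (MonoidAlgebra.single g 1, MonoidAlgebra.single g⁻¹ 1)) (action g) (coaction v)

/-- The braiding `c(v ⊗ w) = v₍₋₁₎ · w ⊗ v₍₀₎` of a Yetter-Drinfeld module. -/
def YetterDrinfeld.braiding {G : Type u} [Group G] {V : Type v} [AddCommGroup V] [Module ℂ V]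
    (Y : YetterDrinfeld G V) : V ⊗[ℂ] V →ₗ[ℂ] V ⊗[ℂ] V :=
  TensorProduct.lift (TensorProduct.lift (LinearMap.mk₂ ℂ
    (fun (x : MonoidAlgebra ℂ G) (v : V) =>
      (TensorProduct.mk ℂ V V).flip v ∘ₗ Y.action.asAlgebraHom x)
    (by intros; ext; simp [TensorProduct.add_tmul])
    (by intros; ext; simp [TensorProduct.smul_tmul'])
    (by intros; ext; simp) (by intros; ext; simp)) ∘ₗ Y.coaction)

variable {V : Type v} [AddCommGroup V] [Module ℂ V] (c : V ⊗[ℂ] V →ₗ[ℂ] V ⊗[ℂ] V)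

/-- The multiplication map `V ⊗ T(V) → T(V)`. -/
def tensorMul : V ⊗[ℂ] TensorAlgebra ℂ V →ₗ[ℂ] TensorAlgebra ℂ V :=
  LinearMap.mul' ℂ (TensorAlgebra ℂ V) ∘ₗ (TensorAlgebra.ι ℂ).rTensor (TensorAlgebra ℂ V)

/-- The map `V ⊗ (V ⊗ T(V)) → V ⊗ T(V)`, `v ⊗ (w ⊗ x) ↦ ∑ w' ⊗ v' x` if
`c(v ⊗ w) = ∑ w' ⊗ v'`. -/
def braidedMul : V ⊗[ℂ] (V ⊗[ℂ] TensorAlgebra ℂ V) →ₗ[ℂ] V ⊗[ℂ] TensorAlgebra ℂ V :=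
  tensorMul.lTensor V ∘ₗ (TensorProduct.assoc ℂ V V (TensorAlgebra ℂ V)).toLinearMap ∘ₗ
    c.rTensor (TensorAlgebra ℂ V) ∘ₗ (TensorProduct.assoc ℂ V V (TensorAlgebra ℂ V)).symm.toLinearMap

/-- The operator `(x, d) ↦ (v x, v ⊗ x + braidedMul (v ⊗ d))` attached to `v`. -/
def coprodStep : V →ₗ[ℂ] Module.End ℂ (TensorAlgebra ℂ V × (V ⊗[ℂ] TensorAlgebra ℂ V)) :=
  LinearMap.mk₂ ℂ
    (fun v z => (TensorAlgebra.ι ℂ v * z.1, v ⊗ₜ[ℂ] z.1 + braidedMul c (v ⊗ₜ[ℂ] z.2)))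
    (by intros; ext <;> simp [add_mul, TensorProduct.add_tmul]; abel)
    (by intros; ext <;> simp [← TensorProduct.smul_tmul'])
    (by intros; ext <;> simp [mul_add, TensorProduct.tmul_add]; abel)
    (by intros; ext <;> simp)

/-- The component `T(V) → V ⊗ T(V)` of the braided comultiplication of `T(V)`: it vanishes at `1`
and maps `v x` to `v ⊗ x + braidedMul (v ⊗ d)` if it maps `x` to `d`. On `V^{⊗ n}` it is
`1 + c₁ + c₁ c₂ + ⋯ + c₁ c₂ ⋯ cₙ₋₁`, where `cᵢ` is `c` on the tensor factors `i`, `i + 1`. -/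
def braidedCoprod : TensorAlgebra ℂ V →ₗ[ℂ] V ⊗[ℂ] TensorAlgebra ℂ V :=
  LinearMap.snd ℂ _ _ ∘ₗ LinearMap.applyₗ (1, 0) ∘ₗ
    (TensorAlgebra.lift ℂ (coprodStep c)).toLinearMap

/-- The quantum symmetrizer `𝔖ₙ = ∑_{w ∈ Sₙ} c_w` on `V^{⊗ n}`, extended by `0` to the other
homogeneous components of `T(V)`; it is given by
`𝔖ₙ₊₁ = (id ⊗ 𝔖ₙ) (1 + c₁ + c₁ c₂ + ⋯ + c₁ ⋯ cₙ)`. -/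
def quantumSymmetrizer : ℕ → TensorAlgebra ℂ V →ₗ[ℂ] TensorAlgebra ℂ V
  | 0 => Algebra.linearMap ℂ (TensorAlgebra ℂ V) ∘ₗ TensorAlgebra.algebraMapInv.toLinearMap
  | n + 1 => tensorMul ∘ₗ (quantumSymmetrizer n).lTensor V ∘ₗ braidedCoprod c

/-- The Nichols algebra `𝔅(V) = T(V) / ⨁ₙ ker 𝔖ₙ` of a braided vector space: two tensors are
identified if all quantum symmetrizers agree on them. -/
abbrev NicholsAlgebra : Type v :=
  RingQuot fun x y : TensorAlgebra ℂ V =>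
    ∀ n, quantumSymmetrizer c n x = quantumSymmetrizer c n y

end Nichols

namespace HopfBimoduleQuiver

variable {G : Type u} [Group G] (Q : HopfBimoduleQuiver.{u, v} G)

/-- `kQ₁¹`, the span of the arrows that start at the vertex `1`. -/
abbrev ArrowsFromOne : Type v := Finsupp.supported ℂ ℂ {a | Q.src a = 1}

theorem ad_mem (g : G) {m : Q.Arrow →₀ ℂ} (hm : m ∈ Finsupp.supported ℂ ℂ {a | Q.src a = 1}) :
    Q.left g (Q.right (.op g⁻¹) m) ∈ Finsupp.supported ℂ ℂ {a | Q.src a = 1} := by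
  rw [Finsupp.supported_eq_span_single] at hm
  induction hm using Submodule.span_induction with
  | mem m hm =>
    obtain ⟨a, ha, rfl⟩ := hm
    refine Finsupp.supported_mono ?_ (left_mem' (right_mem' (arr_mem a) g⁻¹) g)
    rintro b ⟨hb, -⟩
    have ha' : Q.src a = 1 := ha
    simpa [ha'] using hb
  | zero => simp
  | add m n _ _ h1 h2 => simp only [map_add]; exact add_mem h1 h2
  | smul c m _ h => simp only [map_smul]; exact Submodule.smul_mem _ _ h

/-- The adjoint action `ad(g)(m) = g · m · g⁻¹` on `kQ₁¹`. -/
def ad : Representation ℂ G Q.ArrowsFromOne where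
  toFun g := (Q.left g ∘ₗ Q.right (.op g⁻¹)).restrict fun _ hm => Q.ad_mem g hm
  map_one' := by ext m : 2; simp
  map_mul' g h := by
    ext m : 2
    have h1 := Q.left_right h g⁻¹ (Q.right (.op h⁻¹) (m : Q.Arrow →₀ ℂ))
    simp only [MulOpposite.op_inv] at h1
    simp [h1]

/-- The left coaction `δ(a) = t(a) ⊗ a` on `kQ₁¹`. -/
def coaction : Q.ArrowsFromOne →ₗ[ℂ] MonoidAlgebra ℂ G ⊗[ℂ] Q.ArrowsFromOne :=
  Finsupp.linearCombination ℂ (fun a : {a | Q.src a = 1} => MonoidAlgebra.single (Q.tgt a) (1 : ℂ) ⊗ₜ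
    (⟨Q.arr a, Finsupp.single_mem_supported ℂ _ a.2⟩ : Q.ArrowsFromOne)) ∘ₗ
  (Finsupp.supportedEquivFinsupp {a | Q.src a = 1}).toLinearMap

theorem coaction_arr (a : Q.Arrow) (ha : Q.src a = 1) :
    Q.coaction ⟨Q.arr a, Finsupp.single_mem_supported ℂ _ ha⟩ =
      MonoidAlgebra.single (Q.tgt a) (1 : ℂ) ⊗ₜ ⟨Q.arr a, Finsupp.single_mem_supported ℂ _ ha⟩ := by
  have : Finsupp.supportedEquivFinsupp {a | Q.src a = 1}
      ⟨Q.arr a, Finsupp.single_mem_supported ℂ (1 : ℂ) ha⟩ = Finsupp.single ⟨a, ha⟩ (1 : ℂ) := by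
    rw [← LinearEquiv.eq_symm_apply]
    exact Subtype.ext (Finsupp.supportedEquivFinsupp_symm_single {a | Q.src a = 1} ⟨a, ha⟩ (1 : ℂ)).symm
  simp [coaction, this]

theorem supported_ext {α N : Type*} [AddCommMonoid N] [Module ℂ N] {s : Set α}
    {f g : Finsupp.supported ℂ ℂ s →ₗ[ℂ] N}
    (h : ∀ a (ha : a ∈ s), f ⟨Finsupp.single a 1, Finsupp.single_mem_supported ℂ _ ha⟩ =
      g ⟨Finsupp.single a 1, Finsupp.single_mem_supported ℂ _ ha⟩) : f = g := by
  have : f ∘ₗ (Finsupp.supportedEquivFinsupp s).symm.toLinearMap =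
      g ∘ₗ (Finsupp.supportedEquivFinsupp s).symm.toLinearMap := by
    refine Finsupp.lhom_ext' fun a => LinearMap.ext_ring ?_
    have h1 : (Finsupp.supportedEquivFinsupp s).symm (Finsupp.single a (1 : ℂ)) =
        ⟨Finsupp.single a 1, Finsupp.single_mem_supported ℂ (1 : ℂ) a.2⟩ :=
      Subtype.ext (Finsupp.supportedEquivFinsupp_symm_single s a (1 : ℂ))
    simpa [h1] using h a.1 a.2
  refine LinearMap.ext fun m => ?_
  simpa using congr($this (Finsupp.supportedEquivFinsupp s m))

theorem arrows_one_le (y : G) : Q.arrows 1 y ≤ Finsupp.supported ℂ ℂ {a | Q.src a = 1} :=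
  Finsupp.supported_mono fun _ hb => hb.1

theorem coaction_eq {y : G} {m : Q.Arrow →₀ ℂ} (hm : m ∈ Q.arrows 1 y) :
    Q.coaction ⟨m, Q.arrows_one_le y hm⟩ =
      MonoidAlgebra.single y (1 : ℂ) ⊗ₜ ⟨m, Q.arrows_one_le y hm⟩ := by
  have : Q.coaction ∘ₗ Submodule.inclusion (Q.arrows_one_le y) =
      TensorProduct.mk ℂ (MonoidAlgebra ℂ G) Q.ArrowsFromOne (MonoidAlgebra.single y (1 : ℂ)) ∘ₗ
        Submodule.inclusion (Q.arrows_one_le y) := by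
    refine supported_ext ?_
    rintro a ⟨h1, rfl⟩
    exact Q.coaction_arr a h1
  exact congr($this ⟨m, hm⟩)

/-- The Yetter-Drinfeld module `(kQ₁¹, ad)`. -/
def yetterDrinfeld : YetterDrinfeld G Q.ArrowsFromOne where
  action := Q.ad
  coaction := Q.coaction
  counit_coaction := supported_ext fun a ha => by
    have e := Q.coaction_arr a ha
    simp only [arr] at e
    simp [e]
  coassoc := supported_ext fun a ha => by
    have e := Q.coaction_arr a ha
    simp only [arr] at e
    simp [e]
  coaction_action g v := by
    have h : Q.coaction ∘ₗ Q.ad g = TensorProduct.map (LinearMap.mulLeftRight ℂ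
        (MonoidAlgebra.single g 1, MonoidAlgebra.single g⁻¹ 1)) (Q.ad g) ∘ₗ Q.coaction := by
      refine supported_ext fun a ha => ?_
      have h1 := left_mem' (right_mem' (arr_mem a) g⁻¹) g
      rw [ha] at h1
      simp only [one_mul, mul_inv_cancel] at h1
      have e := Q.coaction_arr a ha
      simp only [arr] at e
      simp only [LinearMap.comp_apply, e, TensorProduct.map_tmul]
      refine (Q.coaction_eq h1).trans ?_
      simp only [LinearMap.mulLeftRight_apply, MonoidAlgebra.single_mul_single, mul_one, mul_assoc]
      rfl
    exact congr($h v)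

end HopfBimoduleQuiver

/-! ### Ramification systems with irreducible representations -/

/-- A ramification system with irreducible representations (RSR) `(G, r, ρ⃗, u)`. The ramification
is `r = ∑ r_C C`, the element `u C` is a representative of the class `C`, and `ρ C i`, `i ∈ I C`,
are irreducible representations of the centralizer of `u C` in `G`, the degree of whose direct sum
is `r_C`. (So `I C` is empty exactly if `r_C = 0`; nothing else is recorded for such a class.) -/
structure RSR (G : Type u) [Group G] where
  r : ConjClasses G → Cardinal.{v}
  u : ConjClasses G → G
  mk_u : ∀ C, ConjClasses.mk (u C) = C
  I : ConjClasses G → Type v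
  X : ∀ C, I C → Type v
  [addCommGroup : ∀ C i, AddCommGroup (X C i)]
  [module : ∀ C i, Module ℂ (X C i)]
  ρ : ∀ C i, Representation ℂ (Subgroup.centralizer {u C}) (X C i)
  irreducible : ∀ C i, (ρ C i).IsIrreducible
  deg : ∀ C, Module.rank ℂ (⨁ i, X C i) = r C

namespace RSR

attribute [instance] RSR.addCommGroup RSR.module

variable {G : Type u} [Group G]

/-- `RSR(D, r, ρ⃗, u) ≤ RSR(G, r', ρ⃗', u')`: for each class `C` of `D` with `r_C ≠ 0`, writing
`C_G` for the class of `G` containing `C`, one has `r_C ≤ r'_{C_G}`, `u(C) = u'(C_G)`, the index set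
`I_C` is contained in `I'_{C_G}` (by an injection `ι`), and `ρ_C^{(i)}` is isomorphic to a
subrepresentation of the restriction of `ρ'_{C_G}^{(i)}` to the centralizer of `u(C)` in `D`. -/
def IsSubRSR {D : Subgroup G} (R : RSR.{u, v} D) (R' : RSR.{u, v} G) : Prop :=
  ∀ C : ConjClasses D, R.r C ≠ 0 →
    R.r C ≤ R'.r (C.map D.subtype) ∧
    (R.u C : G) = R'.u (C.map D.subtype) ∧
    ∃ ι : R.I C ↪ R'.I (C.map D.subtype), ∀ i : R.I C,
      ∃ ψ : R.X C i →ₗ[ℂ] R'.X (C.map D.subtype) (ι i), Function.Injective ψ ∧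
        ∀ (d : Subgroup.centralizer {R.u C}) (d' : Subgroup.centralizer {R'.u (C.map D.subtype)}),
          ((d : D) : G) = d' → ∀ x, ψ (R.ρ C i d x) = R'.ρ (C.map D.subtype) (ι i) d' (ψ x)

/-- The choices that enter the construction of the arrow bimodule of an RSR: a basis `x_C^{(i,j)}`,
`j ∈ J C i`, of each representation space, and right coset representatives `g_θ` of the
centralizer of `u C` in `G` for each class `C`. The latter are indexed by the elements `t` of `C`:
`coset t` is the representative of the coset of all `g` with `g⁻¹ u(C) g = t`. -/
structure Choice (R : RSR.{u, v} G) where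
  J : ∀ C, R.I C → Type v
  basis : ∀ C i, Module.Basis (J C i) ℂ (R.X C i)
  coset : G → G
  coset_spec : ∀ t, (coset t)⁻¹ * R.u (ConjClasses.mk t) * coset t = t

namespace Choice

variable {R : RSR.{u, v} G} (P : R.Choice)

/-- The arrow `a_{y,x}^{(i,j)}` from `x = src` to `y = tgt`, where `x⁻¹ y ∈ C`, `i ∈ I C`,
`j ∈ J C i`. -/
@[ext]
structure Arrow where
  src : G
  tgt : G
  C : ConjClasses G
  mk_eq : ConjClasses.mk (src⁻¹ * tgt) = C
  i : R.I C
  j : P.J C i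

/-- The element `ζ_θ(h)` of the centralizer of `u(C)` with `g_θ h = ζ_θ(h) g_θ'`, where
`t = g_θ⁻¹ u(C) g_θ`. -/
def zeta {C : ConjClasses G} {t : G} (ht : ConjClasses.mk t = C) (h : G) :
    Subgroup.centralizer {R.u C} :=
  ⟨P.coset t * h * (P.coset (h⁻¹ * t * h))⁻¹, by
    subst ht
    have h1 := P.coset_spec t
    have h2 := P.coset_spec (h⁻¹ * t * h)
    have h3 : ConjClasses.mk (h⁻¹ * t * h) = ConjClasses.mk t := by
      rw [ConjClasses.mk_eq_mk_iff_isConj, isConj_comm, isConj_iff]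
      exact ⟨h⁻¹, by simp⟩
    rw [h3] at h2
    rw [Subgroup.mem_centralizer_singleton_iff]
    set c := P.coset t
    set s := P.coset (h⁻¹ * t * h)
    set w := R.u (ConjClasses.mk t)
    have h4 : s⁻¹ * w = h⁻¹ * t * h * s⁻¹ := by rw [← h2]; group
    calc c * h * s⁻¹ * w = c * h * (s⁻¹ * w) := by group
      _ = c * t * h * s⁻¹ := by rw [h4]; group
      _ = w * (c * h * s⁻¹) := by
        have : c * t = w * c := by rw [← h1]; group
        rw [this]; group⟩

theorem mk_left {x y : G} {C : ConjClasses G} (h : ConjClasses.mk (x⁻¹ * y) = C) (g : G) :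
    ConjClasses.mk ((g * x)⁻¹ * (g * y)) = C := by
  rw [← h]; congr 1; group

theorem mk_right {x y : G} {C : ConjClasses G} (h : ConjClasses.mk (x⁻¹ * y) = C) (g : G) :
    ConjClasses.mk ((x * g)⁻¹ * (y * g)) = C := by
  rw [← h, ConjClasses.mk_eq_mk_iff_isConj, isConj_iff]
  exact ⟨g, by group⟩

/-- The linear map `X_C^{(i)} → kQ₁`, `x_C^{(i,j)} ↦ a_{y,x}^{(i,j)}`. -/
def arrowVec {x y : G} {C : ConjClasses G} (h : ConjClasses.mk (x⁻¹ * y) = C) (i : R.I C) :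
    R.X C i →ₗ[ℂ] P.Arrow →₀ ℂ :=
  (P.basis C i).constr ℂ fun j => Finsupp.single ⟨x, y, C, h, i, j⟩ 1

/-- The left action `h · a_{y,x}^{(i,j)} = a_{hy,hx}^{(i,j)}`. -/
def leftAction : Representation ℂ G (P.Arrow →₀ ℂ) where
  toFun g := Finsupp.lmapDomain ℂ ℂ fun a => ⟨g * a.src, g * a.tgt, a.C, mk_left a.mk_eq g, a.i, a.j⟩
  map_one' := by ext a : 2; simp
  map_mul' g h := by ext a : 2; simp [mul_assoc]

/-- The right action of `h`: `a_{y,x}^{(i,j)} · h = ∑ₛ k^{(i,j,s)} a_{yh,xh}^{(i,s)}` where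
`x_C^{(i,j)} · ζ_θ(h) = ∑ₛ k^{(i,j,s)} x_C^{(i,s)}`; here `x · z = ρ(z⁻¹)(x)` is the right module
structure on the representation space. -/
def rightLin (h : G) : (P.Arrow →₀ ℂ) →ₗ[ℂ] P.Arrow →₀ ℂ :=
  Finsupp.linearCombination ℂ fun a =>
    P.arrowVec (mk_right a.mk_eq h) a.i (R.ρ a.C a.i (P.zeta a.mk_eq h)⁻¹ (P.basis a.C a.i a.j))

theorem rightLin_arrowVec {x y : G} {C : ConjClasses G} (hC : ConjClasses.mk (x⁻¹ * y) = C)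
    (i : R.I C) (h : G) (v : R.X C i) : P.rightLin h (P.arrowVec hC i v) =
      P.arrowVec (mk_right hC h) i (R.ρ C i (P.zeta hC h)⁻¹ v) := by
  have : P.rightLin h ∘ₗ P.arrowVec hC i =
      P.arrowVec (mk_right hC h) i ∘ₗ R.ρ C i (P.zeta hC h)⁻¹ := by
    refine (P.basis C i).ext fun j => ?_
    simp [arrowVec, rightLin]
  exact congr($this v)

theorem single_eq_arrowVec (a : P.Arrow) :
    Finsupp.single a (1 : ℂ) = P.arrowVec a.mk_eq a.i (P.basis a.C a.i a.j) := by
  simp [arrowVec]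

theorem arrowVec_congr {x y x' y' : G} {C : ConjClasses G} (hx : x = x') (hy : y = y')
    (h : ConjClasses.mk (x⁻¹ * y) = C) (h' : ConjClasses.mk (x'⁻¹ * y') = C) (i : R.I C) :
    P.arrowVec h i = P.arrowVec h' i := by
  subst hx hy; rfl

theorem leftAction_arrowVec {x y : G} {C : ConjClasses G} (hC : ConjClasses.mk (x⁻¹ * y) = C)
    (i : R.I C) (g : G) (v : R.X C i) : P.leftAction g (P.arrowVec hC i v) =
      P.arrowVec (mk_left hC g) i v := by
  have : P.leftAction g ∘ₗ P.arrowVec hC i = P.arrowVec (mk_left hC g) i := by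
    refine (P.basis C i).ext fun j => ?_
    simp [arrowVec, leftAction]
  exact congr($this v)

theorem zeta_mul {x y : G} {C : ConjClasses G} (hC : ConjClasses.mk (x⁻¹ * y) = C) (g h : G) :
    P.zeta hC (g * h) = P.zeta hC g * P.zeta (mk_right hC g) h := by
  apply Subtype.ext
  have h1 : (x * g)⁻¹ * (y * g) = g⁻¹ * (x⁻¹ * y) * g := by group
  have h2 : h⁻¹ * ((x * g)⁻¹ * (y * g)) * h = (g * h)⁻¹ * (x⁻¹ * y) * (g * h) := by group
  simp only [zeta, Subgroup.coe_mul]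
  rw [h2, h1]
  group

theorem zeta_one {t : G} {C : ConjClasses G} (hC : ConjClasses.mk t = C) : P.zeta hC 1 = 1 := by
  apply Subtype.ext
  simp [zeta]

theorem zeta_left {x y : G} {C : ConjClasses G} (hC : ConjClasses.mk (x⁻¹ * y) = C) (g h : G) :
    P.zeta (mk_left hC g) h = P.zeta hC h := by
  apply Subtype.ext
  have h1 : (g * x)⁻¹ * (g * y) = x⁻¹ * y := by group
  simp only [zeta, h1]

theorem arrowVec_mem {x y : G} {C : ConjClasses G} (hC : ConjClasses.mk (x⁻¹ * y) = C)
    (i : R.I C) (v : R.X C i) :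
    P.arrowVec hC i v ∈ Finsupp.supported ℂ ℂ {b : P.Arrow | b.src = x ∧ b.tgt = y} := by
  have : (⊤ : Submodule ℂ (R.X C i)) ≤ (Finsupp.supported ℂ ℂ
      {b : P.Arrow | b.src = x ∧ b.tgt = y}).comap (P.arrowVec hC i) := by
    rw [← (P.basis C i).span_eq, Submodule.span_le]
    rintro _ ⟨j, rfl⟩
    simp only [arrowVec, SetLike.mem_coe, Submodule.mem_comap, Module.Basis.constr_basis]
    exact Finsupp.single_mem_supported ℂ _ ⟨rfl, rfl⟩
  exact this trivial

/-- The right action as a representation of the opposite group. -/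
def rightAction : Representation ℂ Gᵐᵒᵖ (P.Arrow →₀ ℂ) where
  toFun h := P.rightLin h.unop
  map_one' := by
    refine Finsupp.lhom_ext' fun a => LinearMap.ext_ring ?_
    simp only [LinearMap.comp_apply, Finsupp.lsingle_apply, single_eq_arrowVec,
      MulOpposite.unop_one, rightLin_arrowVec, zeta_one, inv_one, map_one, Module.End.one_apply]
    rw [P.arrowVec_congr (mul_one _) (mul_one _)]
  map_mul' g h := by
    refine Finsupp.lhom_ext' fun a => LinearMap.ext_ring ?_
    simp only [LinearMap.comp_apply, Finsupp.lsingle_apply, single_eq_arrowVec,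
      MulOpposite.unop_mul, rightLin_arrowVec, zeta_mul, mul_inv_rev, map_mul, Module.End.mul_apply]
    rw [P.arrowVec_congr (mul_assoc _ _ _).symm (mul_assoc _ _ _).symm]

/-- The Hopf quiver of an RSR, with its arrow Hopf bimodule `kQ₁ᶜ(G, r, ρ⃗, u)`. -/
def quiver : HopfBimoduleQuiver.{u, max u v} G where
  Arrow := P.Arrow
  src := Arrow.src
  tgt := Arrow.tgt
  left := P.leftAction
  right := P.rightAction
  left_right g h m := by
    have : P.leftAction g ∘ₗ P.rightAction (.op h) = P.rightAction (.op h) ∘ₗ P.leftAction g := by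
      refine Finsupp.lhom_ext' fun a => LinearMap.ext_ring ?_
      have hr : P.rightAction (.op h) = P.rightLin h := rfl
      simp only [LinearMap.comp_apply, Finsupp.lsingle_apply, single_eq_arrowVec, hr,
        rightLin_arrowVec, leftAction_arrowVec]
      rw [P.zeta_left a.mk_eq g h, P.arrowVec_congr (mul_assoc _ _ _).symm (mul_assoc _ _ _).symm]
    exact congr($this m)
  left_mem g a := by
    rw [single_eq_arrowVec, leftAction_arrowVec]
    exact P.arrowVec_mem _ _ _
  right_mem h a := by
    have hr : P.rightAction (.op h) = P.rightLin h := rfl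
    rw [single_eq_arrowVec, hr, rightLin_arrowVec]
    exact P.arrowVec_mem _ _ _

/-- The co-path Hopf algebra `kQᶜ(G, r, ρ⃗, u)`. -/
abbrev CoPathHopfAlgebra : Type (max u v) := P.quiver.CoPath

/-- The Hopf algebra `kG[kQ₁ᶜ, G, r, ρ⃗, u]`, the Hopf subalgebra of `kQᶜ(G, r, ρ⃗, u)` generated by
`kG` and `kQ₁ᶜ`. -/
abbrev OneTypeHopfAlgebra : Type (max u v) := P.quiver.oneType.toSubalgebra

/-- The Nichols algebra `𝔅(G, r, ρ⃗, u) = 𝔅(kQ₁¹, ad(G, r, ρ⃗, u))`. -/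
abbrev Nichols : Type (max u v) := NicholsAlgebra P.quiver.yetterDrinfeld.braiding

end Choice

end RSR

/-- A Hopf algebra map is an embedding if it is injective, so that it identifies its source with a
Hopf subalgebra of its target. -/
def IsHopfEmbedding {k A B : Type*} [Field k] [Ring A] [Ring B] [HopfAlgebra k A] [HopfAlgebra k B]
    (f : A →ₐc[k] B) : Prop :=
  Function.Injective f ∧ ∀ a, f (HopfAlgebra.antipode k a) = HopfAlgebra.antipode k (f a)

end

/-!
The inclusion of ramification systems yields a map of the arrow bimodules, and everything else is
functoriality of the constructions in the arrow bimodule.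

*The arrow bimodules.* For `x, y ∈ D` and `t = x⁻¹ y ∈ C`, the arrows `x → y` with index `i` span a
copy of the representation space of `ρ_C^{(i)}`, on which `h` acts from the right through
`g_t h g_s⁻¹ ∈ G^{u(C)}`, where `s = h⁻¹ t h`. The two systems use unrelated coset representatives
`g_t` and `g'_t`, so the embedding `ψ` of `ρ_C^{(i)}` in the representation of the large system is
corrected: `v ↦ g'_t g_t⁻¹ ψ(v)` is an injective map of Hopf bimodules (`RSR.IsSubRSR.embedding`).
It is injective because distinct `i` go to distinct indices of the large system.

*Path coalgebras.* The product and the coproduct of `kQᶜ` are given by recursions in terms of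
`(m, h) ↦ m h`, the prolongation of a path `h` by an arrow `m`. The map `aₙ ⋯ a₁ ↦ φ(aₙ) ⋯ φ(a₁)`
induced by an injective bimodule map `φ` along an injective group homomorphism satisfies
`Φ(m h) = φ(m) Φ(h)` (`HopfBimoduleQuiver.Embedding.coPathMap_cons`), hence preserves both. Any
linear left inverse of `φ` induces one of `Φ`. A bialgebra map between Hopf algebras commutes with
the antipodes, and `Φ` maps the generators of the Hopf subalgebra `kD[kQ₁ᶜ]` into `kG[kQ'₁ᶜ]`.

*Nichols algebras.* `φ` restricts to an injective map of braided vector spaces `V → V'`, and the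
quantum symmetrizers are natural, so that `T(V) → T(V')` is injective and reflects the relation of
having the same values under all of them. The Nichols algebra is the quotient by the ring congruence
generated by this relation. For a Yetter-Drinfeld module the relation is already a congruence
(`YetterDrinfeld.symmetrizerCon`): `𝔖ₙ₊₁(v x)` and `𝔖ₙ₊₁(x v)` are functions of `𝔖ₙ(x)`, namely the
products of the quantum shuffle algebra. On homogeneous tensors the braiding past `v` is explicit,
and `𝔖ₙ` preserves the degree; this replaces the braid equation. Hence the induced map of Nichols
algebras is injective, and finite dimensionality passes from its target to its source.
-/

noncomputable section

/-! ### Bialgebra maps and antipodes -/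

/-- A bialgebra map between Hopf algebras commutes with the antipodes: both composites are
convolution inverses of the map. -/
theorem BialgHom.map_antipode {k A B : Type*} [Field k] [Ring A] [Ring B] [HopfAlgebra k A]
    [HopfAlgebra k B] (f : A →ₐc[k] B) (a : A) :
    f (HopfAlgebra.antipode k a) = HopfAlgebra.antipode k (f a) := by
  have h1 := LinearMap.algHom_comp_convMul_distrib (f : A →ₐ[k] B)
    (WithConv.toConv (HopfAlgebra.antipode k (A := A))) (WithConv.toConv LinearMap.id)
  have h2 := LinearMap.convMul_comp_coalgHom_distrib (WithConv.toConv LinearMap.id)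
    (WithConv.toConv (HopfAlgebra.antipode k (A := B))) (f : A →ₗc[k] B)
  rw [LinearMap.antipode_mul_id] at h1
  rw [LinearMap.id_mul_antipode] at h2
  have h3 : (f : A →ₐ[k] B).toLinearMap ∘ₗ (1 : WithConv (A →ₗ[k] A)).ofConv =
      (1 : WithConv (A →ₗ[k] B)).ofConv := by
    ext x; simpa using AlgHomClass.commutes f _
  have h4 : (1 : WithConv (B →ₗ[k] B)).ofConv ∘ₗ (f : A →ₗc[k] B).toLinearMap =
      (1 : WithConv (A →ₗ[k] B)).ofConv := by
    ext x; simp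
  exact congr($(left_inv_eq_right_inv (WithConv.ext (h1.symm.trans h3))
    (WithConv.ext (h2.symm.trans h4))) a)

namespace HopfBimoduleQuiver

variable {D G : Type*} [Group D] [Group G] {Q : HopfBimoduleQuiver D} {Q' : HopfBimoduleQuiver G}

/-! ### Maps of path coalgebras -/

/-- The image of a path under a map `τ` of vertices and a linear map `φ` of arrow spaces:
`aₙ ⋯ a₁ ↦ φ(aₙ) ⋯ φ(a₁)`, and `x ↦ τ(x)` for a vertex. -/
def pathMapAux (τ : D → G) (φ : (Q.Arrow →₀ ℂ) →ₗ[ℂ] Q'.Arrow →₀ ℂ) :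
    ∀ {y : D}, Q.PathTo y → Q'.CoPath
  | _, .vertex x => Q'.vert (τ x)
  | _, .cons a p => Q'.cons (φ (Q.arr a)) (pathMapAux τ φ p)

/-- The linear map `kQᶜ → kQ'ᶜ` with `aₙ ⋯ a₁ ↦ φ(aₙ) ⋯ φ(a₁)`. -/
def pathMap (τ : D → G) (φ : (Q.Arrow →₀ ℂ) →ₗ[ℂ] Q'.Arrow →₀ ℂ) : Q.CoPath →ₗ[ℂ] Q'.CoPath :=
  Q.extend (pathMapAux τ φ)

section pathMap

variable (τ : D → G) (φ : (Q.Arrow →₀ ℂ) →ₗ[ℂ] Q'.Arrow →₀ ℂ)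

theorem pathMap_vert (x : D) : pathMap τ φ (Q.vert x) = Q'.vert (τ x) := by
  simp [pathMap, vert, pathMapAux]

theorem pathMap_path_cons (a : Q.Arrow) (p : Q.PathTo (Q.src a)) :
    pathMap τ φ (Q.path (.cons a p)) = Q'.cons (φ (Q.arr a)) (pathMap τ φ (Q.path p)) := by
  simp [pathMap, pathMapAux]

theorem pathMap_cons_of_mem {x y : D} {m : Q.Arrow →₀ ℂ} (hm : m ∈ Q.arrows x y) {h : Q.CoPath}
    (hh : h ∈ Q.endsAt x) : pathMap τ φ (Q.cons m h) = Q'.cons (φ m) (pathMap τ φ h) := by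
  induction hm using arrows_induction with
  | h0 => simp
  | ha m n _ _ h1 h2 => simp [h1, h2]
  | hs c m _ h => simp [h]
  | hp a h1 h2 =>
    subst h1 h2
    induction hh using Submodule.span_induction with
    | mem h hh => obtain ⟨p, rfl⟩ := hh; simp [cons_path, pathMap_path_cons]
    | zero => simp
    | add x y _ _ hx hy => simp [hx, hy]
    | smul c x _ hx => simp [hx]

end pathMap

variable (Q Q') in
/-- An embedding of quivers with arrow Hopf bimodules: an injective group homomorphism together with
an injective linear map of arrow spaces that is a map of Hopf bimodules along it. -/
structure Embedding where
  toMonoidHom : D →* G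
  injective : Function.Injective toMonoidHom
  arrowMap : (Q.Arrow →₀ ℂ) →ₗ[ℂ] Q'.Arrow →₀ ℂ
  arrowMap_injective : Function.Injective arrowMap
  arrowMap_arr_mem : ∀ a, arrowMap (Q.arr a) ∈
    Q'.arrows (toMonoidHom (Q.src a)) (toMonoidHom (Q.tgt a))
  arrowMap_left : ∀ g m, arrowMap (Q.left g m) = Q'.left (toMonoidHom g) (arrowMap m)
  arrowMap_right : ∀ g m,
    arrowMap (Q.right (.op g) m) = Q'.right (.op (toMonoidHom g)) (arrowMap m)

namespace Embedding

variable (E : Embedding Q Q')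

theorem arrowMap_mem {x y : D} {m : Q.Arrow →₀ ℂ} (hm : m ∈ Q.arrows x y) :
    E.arrowMap m ∈ Q'.arrows (E.toMonoidHom x) (E.toMonoidHom y) := by
  induction hm using arrows_induction with
  | h0 => simp
  | ha m n _ _ h1 h2 => rw [map_add]; exact add_mem h1 h2
  | hs c m _ h => rw [map_smul]; exact Submodule.smul_mem _ _ h
  | hp a h1 h2 => subst h1 h2; exact E.arrowMap_arr_mem a

/-- The linear map of path coalgebras induced by an embedding. -/
def coPathMap : Q.CoPath →ₗ[ℂ] Q'.CoPath := pathMap E.toMonoidHom E.arrowMap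

theorem coPathMap_vert (x : D) : E.coPathMap (Q.vert x) = Q'.vert (E.toMonoidHom x) :=
  pathMap_vert _ _ x

theorem coPathMap_path_mem {y : D} (p : Q.PathTo y) :
    E.coPathMap (Q.path p) ∈ Q'.endsAt (E.toMonoidHom y) := by
  cases p with
  | vertex x => exact (E.coPathMap_vert _).symm ▸ vert_mem _
  | cons a p =>
    rw [coPathMap, pathMap_path_cons]
    exact cons_mem (E.arrowMap_arr_mem a) _

theorem coPathMap_cons (m : Q.Arrow →₀ ℂ) (h : Q.CoPath) :
    E.coPathMap (Q.cons m h) = Q'.cons (E.arrowMap m) (E.coPathMap h) := by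
  induction m using Finsupp.induction_linear with
  | zero => simp
  | add m n h1 h2 => simp [h1, h2]
  | single a c =>
    rw [← Finsupp.smul_single_one a c]
    simp only [map_smul, LinearMap.smul_apply]
    congr 1
    induction h using coPath_induction with
    | h0 => simp
    | ha m n h1 h2 => simp [h1, h2]
    | hs c m h => simp [h]
    | hp y p =>
      by_cases h : y = Q.src a
      · subst h; rw [cons_path, coPathMap, pathMap_path_cons]
      -- Injectivity on vertices: a pair that is not composable stays so.
      · rw [cons_path_of_ne h, map_zero, cons_eq_zero (E.arrowMap_arr_mem a)
          (E.coPathMap_path_mem p) (E.injective.ne h)]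

theorem coPathMap_arrow (m : Q.Arrow →₀ ℂ) :
    E.coPathMap (Q.arrow m) = Q'.arrow (E.arrowMap m) := by
  induction m using Finsupp.induction_linear with
  | zero => simp
  | add m n h1 h2 => simp [h1, h2]
  | single a c =>
    rw [← Finsupp.smul_single_one a c]
    simp only [map_smul]
    congr 1
    have key : ∀ {x y : G} {m : Q'.Arrow →₀ ℂ}, m ∈ Q'.arrows x y →
        Q'.arrow m = Q'.cons m (Q'.vert x) := by
      intro x y m hm
      induction hm using arrows_induction with
      | h0 => simp
      | ha m n _ _ h1 h2 => simp [h1, h2]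
      | hs c m _ h => simp [h]
      | hp b h1 h2 => subst h1 h2; simp [arrow, vert, cons_path]
    rw [key (E.arrowMap_arr_mem a), ← E.coPathMap_vert, ← E.coPathMap_cons]
    simp [arrow, vert, cons_path]

theorem coPathMap_injective : Function.Injective E.coPathMap := by
  obtain ⟨r, hr⟩ := E.arrowMap.exists_leftInverse_of_injective
    (LinearMap.ker_eq_bot.2 E.arrowMap_injective)
  -- A linear left inverse of the arrow map induces one on paths: `pathMap_cons_of_mem` needs no
  -- compatibility with sources and targets.
  have key : pathMap (Function.invFun E.toMonoidHom) r ∘ₗ E.coPathMap = LinearMap.id := by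
    refine hom_ext fun y p => ?_
    induction p with
    | vertex x =>
      change pathMap _ r (E.coPathMap (Q.vert x)) = Q.vert x
      rw [coPathMap_vert, pathMap_vert, Function.leftInverse_invFun E.injective]
    | cons a p ih =>
      rw [LinearMap.comp_apply] at ih ⊢
      rw [← cons_path, coPathMap_cons,
        pathMap_cons_of_mem _ _ (E.arrowMap_arr_mem a) (E.coPathMap_path_mem p), ih,
        show r (E.arrowMap (Q.arr a)) = Q.arr a from congr($hr (Q.arr a))]
      rfl
  exact Function.LeftInverse.injective (g := pathMap _ r) fun h => congr($key h)

theorem coPathMap_path_mul_path {y z : D} (p : Q.PathTo y) (q : Q.PathTo z) :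
    E.coPathMap (Q.path p * Q.path q) = E.coPathMap (Q.path p) * E.coPathMap (Q.path q) := by
  induction p generalizing z with
  | vertex x =>
    change E.coPathMap (Q.vert x * _) = E.coPathMap (Q.vert x) * _
    induction q with
    | vertex y =>
      change E.coPathMap (_ * Q.vert y) = _ * E.coPathMap (Q.vert y)
      simp [vert_mul_vert, coPathMap_vert]
    | cons b q ih =>
      rw [← cons_path, vert_mul_cons, coPathMap_cons, ih, coPathMap_cons, coPathMap_vert,
        vert_mul_cons, arrowMap_left]
  | cons a p ihp =>
    induction q with
    | vertex y =>
      have h1 := ihp (.vertex y)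
      change E.coPathMap (_ * Q.vert y) = _ * E.coPathMap (Q.vert y) at h1 ⊢
      rw [← cons_path, cons_mul_vert, coPathMap_cons, h1, coPathMap_cons, coPathMap_vert,
        cons_mul_vert, arrowMap_right]
    | cons b q ih =>
      have h1 := ihp (.cons b q)
      clear ihp
      have ha := arr_mem a
      have hb := arr_mem b
      rw [← cons_path b] at h1
      rw [← cons_path a] at ih
      rw [← cons_path a, ← cons_path b, cons_mul_cons ha hb, map_add, coPathMap_cons,
        coPathMap_cons _ (Q.left _ _), h1, ih, coPathMap_cons, coPathMap_cons,
        cons_mul_cons (E.arrowMap_mem ha) (E.arrowMap_mem hb), arrowMap_left, arrowMap_right]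

theorem coPathMap_mul (h k : Q.CoPath) :
    E.coPathMap (h * k) = E.coPathMap h * E.coPathMap k := by
  have : Q.mulLin.compr₂ E.coPathMap = Q'.mulLin.compl₁₂ E.coPathMap E.coPathMap :=
    bilin_ext fun _ _ p q => E.coPathMap_path_mul_path p q
  exact congr($this h k)

theorem map_comp_comulLin : TensorProduct.map E.coPathMap E.coPathMap ∘ₗ Q.comulLin =
    Q'.comulLin ∘ₗ E.coPathMap := by
  refine hom_ext fun y p => ?_
  simp only [LinearMap.comp_apply]
  induction p with
  | vertex x =>
    change TensorProduct.map _ _ (Q.comulLin (Q.vert x)) = Q'.comulLin (E.coPathMap (Q.vert x))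
    simp [comul_vert, coPathMap_vert]
  | cons a p ih =>
    have h : E.coPathMap ∘ₗ Q.cons (Q.arr a) = Q'.cons (E.arrowMap (Q.arr a)) ∘ₗ E.coPathMap :=
      LinearMap.ext (E.coPathMap_cons _)
    rw [← cons_path, comul_cons_arr, coPathMap_cons, comul_cons (E.arrowMap_arr_mem a), ← ih,
      map_add, TensorProduct.map_tmul, coPathMap_vert, coPathMap_cons,
      ← LinearMap.comp_apply (TensorProduct.map _ _) (LinearMap.rTensor _ _),
      LinearMap.map_comp_rTensor, h, ← LinearMap.rTensor_comp_map, LinearMap.comp_apply]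

theorem counitLin_comp : Q'.counitLin ∘ₗ E.coPathMap = Q.counitLin := by
  refine hom_ext fun y p => ?_
  cases p with
  | vertex x =>
    change Q'.counitLin (E.coPathMap (Q.vert _)) = Q.counitLin (Q.vert _)
    simp [coPathMap_vert, counit_vert]
  | cons a p =>
    rw [LinearMap.comp_apply, ← cons_path, coPathMap_cons, counit_cons, counit_cons]

/-- The bialgebra map of path coalgebras induced by an embedding. -/
def coPathHom : Q.CoPath →ₐc[ℂ] Q'.CoPath :=
  BialgHom.ofAlgHom
    (AlgHom.ofLinearMap E.coPathMap ((E.coPathMap_vert 1).trans (by rw [map_one]; rfl))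
      E.coPathMap_mul)
    (AlgHom.toLinearMap_injective E.counitLin_comp)
    (AlgHom.toLinearMap_injective E.map_comp_comulLin)

theorem isHopfEmbedding_coPathHom : IsHopfEmbedding E.coPathHom :=
  ⟨E.coPathMap_injective, BialgHom.map_antipode _⟩

theorem coPathHom_mem_oneType {h : Q.CoPath} (hh : h ∈ Q.oneType.toSubalgebra) :
    E.coPathHom h ∈ Q'.oneType.toSubalgebra := by
  have harrow : ∀ m, Q'.arrow m ∈ Q'.oneType.toSubalgebra := by
    intro m
    induction m using Finsupp.induction_linear with
    | zero => rw [map_zero]; exact zero_mem _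
    | add m n h1 h2 => rw [map_add]; exact add_mem h1 h2
    | single a c =>
      rw [← Finsupp.smul_single_one a c, map_smul]
      exact Subalgebra.smul_mem _ (show Q'.arrow (Q'.arr a) ∈ Q'.oneType.toSubalgebra from
        Algebra.subset_adjoin (Or.inr ⟨a, rfl⟩)) c
  suffices hle : Q.oneType.toSubalgebra ≤
      Q'.oneType.toSubalgebra.comap (E.coPathHom : Q.CoPath →ₐ[ℂ] Q'.CoPath) from hle hh
  refine Algebra.adjoin_le ?_
  rintro _ (⟨x, rfl⟩ | ⟨a, rfl⟩)
  · exact Algebra.subset_adjoin (Or.inl ⟨_, (E.coPathMap_vert x).symm⟩)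
  · change E.coPathMap (Q.arrow (Q.arr a)) ∈ Q'.oneType.toSubalgebra
    rw [coPathMap_arrow]
    exact harrow _

end Embedding

end HopfBimoduleQuiver

/-! ### Restriction to Hopf subalgebras -/

/-- The restriction of a bialgebra map to Hopf subalgebras. -/
def HopfSubalgebra.restrictHom {k A B : Type*} [Field k] [Ring A] [Ring B] [HopfAlgebra k A]
    [HopfAlgebra k B] (f : A →ₐc[k] B) (K : HopfSubalgebra k A) (L : HopfSubalgebra k B)
    (h : ∀ x ∈ K.toSubalgebra, f x ∈ L.toSubalgebra) : K.toSubalgebra →ₐc[k] L.toSubalgebra :=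
  let g : K.toSubalgebra →ₐ[k] L.toSubalgebra :=
    ((f : A →ₐ[k] B).comp K.toSubalgebra.val).codRestrict L.toSubalgebra fun x => h x x.2
  BialgHom.ofAlgHom g
    (AlgHom.ext fun x => CoalgHomClass.counit_comp_apply f (x : A))
    (AlgHom.ext fun x => L.map_val_injective <| by
      have hg : (Algebra.TensorProduct.map L.toSubalgebra.val L.toSubalgebra.val).comp
          (Algebra.TensorProduct.map g g) = (Algebra.TensorProduct.map (f : A →ₐ[k] B)
            (f : A →ₐ[k] B)).comp
          (Algebra.TensorProduct.map K.toSubalgebra.val K.toSubalgebra.val) := by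
        ext <;> rfl
      refine (congr($hg (K.comulAlgHom x))).trans ?_
      refine Eq.trans ?_ (L.map_comulAlgHom (g x)).symm
      refine (congrArg _ (K.map_comulAlgHom x)).trans ?_
      exact CoalgHomClass.map_comp_comul_apply f (x : A))


/-! ### The braided comultiplication and the quantum symmetrizers -/

/-- Induction over the tensor algebra by multiplication with vectors from the left. -/
theorem TensorAlgebra.left_induction {V : Type*} [AddCommGroup V] [Module ℂ V]
    {P : TensorAlgebra ℂ V → Prop} (h1 : P 1) (ha : ∀ x y, P x → P y → P (x + y))
    (hs : ∀ (c : ℂ) x, P x → P (c • x)) (hι : ∀ v x, P x → P (TensorAlgebra.ι ℂ v * x))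
    (x : TensorAlgebra ℂ V) : P x := by
  have key : ∀ y, P y → P (x * y) := by
    induction x using TensorAlgebra.induction with
    | algebraMap r => intro y hy; rw [← Algebra.smul_def]; exact hs r y hy
    | ι v => exact hι v
    | mul x y hx hy => intro z hz; rw [mul_assoc]; exact hx _ (hy z hz)
    | add x y hx hy => intro z hz; rw [add_mul]; exact ha _ _ (hx z hz) (hy z hz)
  simpa using key 1 h1

section Braided

variable {V W : Type*} [AddCommGroup V] [Module ℂ V] [AddCommGroup W] [Module ℂ W]
  (c : V ⊗[ℂ] V →ₗ[ℂ] V ⊗[ℂ] V) (c' : W ⊗[ℂ] W →ₗ[ℂ] W ⊗[ℂ] W)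

@[simp] theorem tensorMul_tmul (v : V) (x : TensorAlgebra ℂ V) :
    tensorMul (v ⊗ₜ[ℂ] x) = TensorAlgebra.ι ℂ v * x := rfl

theorem braidedMul_tmul_tmul (v w : V) (x : TensorAlgebra ℂ V) :
    braidedMul c (v ⊗ₜ[ℂ] (w ⊗ₜ[ℂ] x)) = tensorMul.lTensor V
      (TensorProduct.assoc ℂ V V (TensorAlgebra ℂ V) (c (v ⊗ₜ[ℂ] w) ⊗ₜ[ℂ] x)) := rfl

@[simp] theorem braidedCoprod_one : braidedCoprod c 1 = 0 := by simp [braidedCoprod]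

theorem braidedCoprod_ι_mul (v : V) (x : TensorAlgebra ℂ V) :
    braidedCoprod c (TensorAlgebra.ι ℂ v * x) =
      v ⊗ₜ[ℂ] x + braidedMul c (v ⊗ₜ[ℂ] braidedCoprod c x) := by
  have hfst : ∀ (x : TensorAlgebra ℂ V) z,
      (TensorAlgebra.lift ℂ (coprodStep c) x z).1 = x * z.1 := by
    intro x
    induction x using TensorAlgebra.induction with
    | algebraMap r => intro z; simp [Algebra.smul_def, Module.algebraMap_end_apply]
    | ι v => intro z; simp [coprodStep]
    | mul x y hx hy => intro z; simp [hx, hy, mul_assoc]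
    | add x y hx hy => intro z; simp [hx, hy, add_mul]
  have h := hfst x (1, 0)
  rw [mul_one] at h
  simp only [braidedCoprod, LinearMap.comp_apply, AlgHom.toLinearMap_apply, map_mul,
    TensorAlgebra.lift_ι_apply, LinearMap.applyₗ_apply_apply, Module.End.mul_apply]
  change v ⊗ₜ[ℂ] (TensorAlgebra.lift ℂ (coprodStep c) x (1, 0)).1 + _ = _
  rw [h]
  rfl

/-- For the braiding `0` the braided comultiplication is a left inverse of `V ⊗ T(V) → T(V)`. -/
theorem braidedCoprod_zero_tensorMul (d : V ⊗[ℂ] TensorAlgebra ℂ V) :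
    braidedCoprod 0 (tensorMul d) = d := by
  have h0 : braidedMul (0 : V ⊗[ℂ] V →ₗ[ℂ] V ⊗[ℂ] V) = 0 := by simp [braidedMul]
  induction d with
  | zero => simp
  | add s t hs ht => rw [map_add, map_add, hs, ht]
  | tmul v x => simp [braidedCoprod_ι_mul, h0]

theorem quantumSymmetrizer_succ (n : ℕ) (x : TensorAlgebra ℂ V) : quantumSymmetrizer c (n + 1) x =
    tensorMul ((quantumSymmetrizer c n).lTensor V (braidedCoprod c x)) := rfl

theorem braidedCoprod_zero_quantumSymmetrizer_succ (n : ℕ) (x : TensorAlgebra ℂ V) :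
    braidedCoprod 0 (quantumSymmetrizer c (n + 1) x) =
      (quantumSymmetrizer c n).lTensor V (braidedCoprod c x) :=
  braidedCoprod_zero_tensorMul _

theorem quantumSymmetrizer_zero_one : quantumSymmetrizer c 0 1 = 1 := by
  simp [quantumSymmetrizer]

theorem quantumSymmetrizer_zero_ι_mul (v : V) (x : TensorAlgebra ℂ V) :
    quantumSymmetrizer c 0 (TensorAlgebra.ι ℂ v * x) = 0 := by
  simp [quantumSymmetrizer, TensorAlgebra.algebraMapInv]

theorem quantumSymmetrizer_zero_mul_ι (v : V) (x : TensorAlgebra ℂ V) :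
    quantumSymmetrizer c 0 (x * TensorAlgebra.ι ℂ v) = 0 := by
  simp [quantumSymmetrizer, TensorAlgebra.algebraMapInv]

/-! ### Functoriality -/

variable (f : V →ₗ[ℂ] W)

/-- The algebra map `T(f) : T(V) → T(W)` induced by a linear map `f : V → W`. -/
def tensorAlgebraMap : TensorAlgebra ℂ V →ₐ[ℂ] TensorAlgebra ℂ W :=
  TensorAlgebra.lift ℂ (TensorAlgebra.ι ℂ ∘ₗ f)

@[simp] theorem tensorAlgebraMap_ι (v : V) :
    tensorAlgebraMap f (TensorAlgebra.ι ℂ v) = TensorAlgebra.ι ℂ (f v) := by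
  simp [tensorAlgebraMap]

theorem tensorAlgebraMap_injective (hf : Function.Injective f) :
    Function.Injective (tensorAlgebraMap f) := by
  obtain ⟨r, hr⟩ := f.exists_leftInverse_of_injective (LinearMap.ker_eq_bot.2 hf)
  have h : (tensorAlgebraMap r).comp (tensorAlgebraMap f) = AlgHom.id ℂ _ := by
    ext v
    simp [← LinearMap.comp_apply r f, hr]
  exact Function.LeftInverse.injective (g := tensorAlgebraMap r) fun x => congr($h x)

variable {c c' f}

theorem braidedMul_map (hc : c' ∘ₗ TensorProduct.map f f = TensorProduct.map f f ∘ₗ c)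
    (v : V) (d : V ⊗[ℂ] TensorAlgebra ℂ V) :
    braidedMul c' (f v ⊗ₜ[ℂ] TensorProduct.map f (tensorAlgebraMap f).toLinearMap d) =
      TensorProduct.map f (tensorAlgebraMap f).toLinearMap (braidedMul c (v ⊗ₜ[ℂ] d)) := by
  induction d with
  | zero => simp
  | add s t hs ht => simp only [map_add, TensorProduct.tmul_add, hs, ht]
  | tmul w x =>
    have h : c' (f v ⊗ₜ[ℂ] f w) = TensorProduct.map f f (c (v ⊗ₜ[ℂ] w)) := congr($hc (v ⊗ₜ[ℂ] w))
    rw [TensorProduct.map_tmul, braidedMul_tmul_tmul, braidedMul_tmul_tmul, h]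
    generalize c (v ⊗ₜ[ℂ] w) = t
    induction t with
    | zero => simp
    | add s t hs ht => simp only [map_add, TensorProduct.add_tmul, hs, ht]
    | tmul a b => simp

theorem braidedCoprod_tensorAlgebraMap
    (hc : c' ∘ₗ TensorProduct.map f f = TensorProduct.map f f ∘ₗ c)
    (x : TensorAlgebra ℂ V) :
    braidedCoprod c' (tensorAlgebraMap f x) =
      TensorProduct.map f (tensorAlgebraMap f).toLinearMap (braidedCoprod c x) := by
  induction x using TensorAlgebra.left_induction with
  | h1 => simp
  | ha x y hx hy => simp only [map_add, hx, hy]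
  | hs c x hx => simp only [map_smul, hx]
  | hι v x hx =>
    rw [map_mul, tensorAlgebraMap_ι, braidedCoprod_ι_mul, hx, braidedMul_map hc,
      braidedCoprod_ι_mul, map_add]
    rfl

theorem quantumSymmetrizer_tensorAlgebraMap
    (hc : c' ∘ₗ TensorProduct.map f f = TensorProduct.map f f ∘ₗ c)
    (n : ℕ) (x : TensorAlgebra ℂ V) :
    quantumSymmetrizer c' n (tensorAlgebraMap f x) =
      tensorAlgebraMap f (quantumSymmetrizer c n x) := by
  induction n generalizing x with
  | zero =>
    induction x using TensorAlgebra.left_induction with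
    | h1 => simp [quantumSymmetrizer_zero_one]
    | ha x y hx hy => simp only [map_add, hx, hy]
    | hs c x hx => simp only [map_smul, hx]
    | hι v x hx =>
      rw [map_mul, tensorAlgebraMap_ι, quantumSymmetrizer_zero_ι_mul,
        quantumSymmetrizer_zero_ι_mul, map_zero]
  | succ n ih =>
    rw [quantumSymmetrizer_succ, quantumSymmetrizer_succ, braidedCoprod_tensorAlgebraMap hc]
    generalize braidedCoprod c x = d
    induction d with
    | zero => simp
    | add s t hs ht => simp only [map_add, hs, ht]
    | tmul v x => simp [ih]

end Braided

/-! ### The kernel of the quantum symmetrizers of a Yetter-Drinfeld module -/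

section RightMul

variable {V : Type*} [AddCommGroup V] [Module ℂ V] (c : V ⊗[ℂ] V →ₗ[ℂ] V ⊗[ℂ] V)

theorem braidedMul_lTensor_mulRight (v : V) (y : TensorAlgebra ℂ V)
    (d : V ⊗[ℂ] TensorAlgebra ℂ V) :
    braidedMul c (v ⊗ₜ[ℂ] (LinearMap.mulRight ℂ y).lTensor V d) =
      (LinearMap.mulRight ℂ y).lTensor V (braidedMul c (v ⊗ₜ[ℂ] d)) := by
  induction d with
  | zero => simp
  | add s t hs ht => simp only [map_add, TensorProduct.tmul_add, hs, ht]
  | tmul w x =>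
    rw [LinearMap.lTensor_tmul, braidedMul_tmul_tmul, braidedMul_tmul_tmul]
    generalize c (v ⊗ₜ[ℂ] w) = t
    induction t with
    | zero => simp
    | add s t hs ht => simp only [map_add, TensorProduct.add_tmul, hs, ht]
    | tmul a b => simp [mul_assoc]

/-- The action of `T(V)` on `V ⊗ T(V)` in which `v` acts by `braidedMul`. On `w ⊗ 1`, a product of
`n` vectors acts by `c₁ c₂ ⋯ cₙ`: it is braided past `w`. -/
def braidedRep : TensorAlgebra ℂ V →ₐ[ℂ] Module.End ℂ (V ⊗[ℂ] TensorAlgebra ℂ V) :=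
  TensorAlgebra.lift ℂ (TensorProduct.curry (braidedMul c))

@[simp] theorem braidedRep_ι (v : V) (d : V ⊗[ℂ] TensorAlgebra ℂ V) :
    braidedRep c (TensorAlgebra.ι ℂ v) d = braidedMul c (v ⊗ₜ[ℂ] d) := by
  simp [braidedRep]

theorem braidedCoprod_mul_ι (x : TensorAlgebra ℂ V) (v : V) :
    braidedCoprod c (x * TensorAlgebra.ι ℂ v) =
      (LinearMap.mulRight ℂ (TensorAlgebra.ι ℂ v)).lTensor V (braidedCoprod c x) +
        braidedRep c x (v ⊗ₜ[ℂ] 1) := by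
  induction x using TensorAlgebra.left_induction with
  | h1 =>
    have := braidedCoprod_ι_mul c v 1
    simp at this ⊢
    exact this
  | ha x y hx hy => simp only [add_mul, map_add, hx, hy, LinearMap.add_apply]; abel
  | hs c x hx => simp only [smul_mul_assoc, map_smul, hx, LinearMap.smul_apply, smul_add]
  | hι w x hx =>
    rw [mul_assoc, braidedCoprod_ι_mul, hx, TensorProduct.tmul_add, map_add,
      braidedMul_lTensor_mulRight, braidedCoprod_ι_mul, map_add, map_mul, Module.End.mul_apply,
      braidedRep_ι, LinearMap.lTensor_tmul, LinearMap.mulRight_apply, add_assoc]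

end RightMul

namespace YetterDrinfeld

variable {G : Type*} [Group G] {V : Type*} [AddCommGroup V] [Module ℂ V] (Y : YetterDrinfeld G V)

/-- `v` is homogeneous of degree `g` if `δ(v) = g ⊗ v`. -/
def IsHomogeneous (g : G) (v : V) : Prop := Y.coaction v = MonoidAlgebra.single g (1 : ℂ) ⊗ₜ[ℂ] v

theorem exists_coaction_eq (v : V) : ∃ m : G →₀ V,
    Y.coaction v = m.sum fun g w => MonoidAlgebra.single g (1 : ℂ) ⊗ₜ[ℂ] w := by
  classical
  generalize Y.coaction v = t
  induction t with
  | zero => exact ⟨0, by simp⟩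
  | add s t hs ht =>
    obtain ⟨m, rfl⟩ := hs
    obtain ⟨n, rfl⟩ := ht
    exact ⟨m + n, (Finsupp.sum_add_index' (by simp) (by simp [TensorProduct.tmul_add])).symm⟩
  | tmul a w =>
    induction a using MonoidAlgebra.induction_linear with
    | zero => exact ⟨0, by simp⟩
    | add a b ha hb =>
      obtain ⟨m, hm⟩ := ha
      obtain ⟨n, hn⟩ := hb
      exact ⟨m + n, by
        rw [TensorProduct.add_tmul, hm, hn,
          Finsupp.sum_add_index' (by simp) (by simp [TensorProduct.tmul_add])]⟩
    | single g r =>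
      refine ⟨Finsupp.single g (r • w), ?_⟩
      rw [Finsupp.sum_single_index (by simp), TensorProduct.tmul_smul, TensorProduct.smul_tmul']
      simp

/-- A comodule over the group algebra is the sum of its homogeneous components. -/
theorem span_isHomogeneous : Submodule.span ℂ {v | ∃ g, Y.IsHomogeneous g v} = ⊤ := by
  classical
  refine eq_top_iff.2 fun v _ => ?_
  obtain ⟨m, hm⟩ := Y.exists_coaction_eq v
  have h1 := congr($Y.counit_coaction v)
  simp only [LinearMap.comp_apply, hm, Finsupp.sum, map_sum, LinearMap.rTensor_tmul,
    TensorProduct.mk_apply] at h1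
  have h1' := congrArg (TensorProduct.lid ℂ V) h1
  simp at h1'
  have h2 := congr($Y.coassoc v)
  simp only [LinearMap.comp_apply, hm, Finsupp.sum, map_sum, LinearMap.rTensor_tmul,
    LinearMap.lTensor_tmul] at h2
  rw [← h1']
  refine Submodule.sum_mem _ fun g hg => Submodule.subset_span ⟨g, ?_⟩
  have h3 := congrArg ((TensorProduct.lid ℂ _).toLinearMap ∘ₗ ((Finsupp.lapply g ∘ₗ
    (MonoidAlgebra.coeffLinearEquiv ℂ).toLinearMap : MonoidAlgebra ℂ G →ₗ[ℂ] ℂ)).rTensor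
      (MonoidAlgebra ℂ G ⊗[ℂ] V)) h2
  simp [Finsupp.single_apply, MonoidAlgebra.coeff_single] at h3
  rw [if_neg (Finsupp.mem_support_iff.1 hg), if_neg (Finsupp.mem_support_iff.1 hg)] at h3
  exact h3.symm

variable {Y} in
theorem IsHomogeneous.action {g : G} {v : V} (hv : Y.IsHomogeneous g v) (h : G) :
    Y.IsHomogeneous (h * g * h⁻¹) (Y.action h v) := by
  rw [IsHomogeneous, Y.coaction_action, hv]
  simp [LinearMap.mulLeftRight_apply, MonoidAlgebra.single_mul_single, mul_assoc]

variable {Y} in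
theorem IsHomogeneous.braiding_tmul {g : G} {v : V} (hv : Y.IsHomogeneous g v) (w : V) :
    Y.braiding (v ⊗ₜ[ℂ] w) = Y.action g w ⊗ₜ[ℂ] v := by
  rw [IsHomogeneous] at hv
  simp [YetterDrinfeld.braiding, hv]

variable {Y} in
theorem IsHomogeneous.braidedMul_tmul {g : G} {v : V} (hv : Y.IsHomogeneous g v)
    (d : V ⊗[ℂ] TensorAlgebra ℂ V) : braidedMul Y.braiding (v ⊗ₜ[ℂ] d) =
      TensorProduct.map (Y.action g) (LinearMap.mulLeft ℂ (TensorAlgebra.ι ℂ v)) d := by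
  induction d with
  | zero => simp
  | add s t hs ht => simp only [map_add, TensorProduct.tmul_add, hs, ht]
  | tmul w x => simp [braidedMul_tmul_tmul, hv.braiding_tmul]

/-- `x` is a product of homogeneous vectors whose degrees have the product `g`. -/
inductive IsMonomial : G → TensorAlgebra ℂ V → Prop
  | one : IsMonomial 1 1
  | ι_mul {g h : G} {v : V} {x : TensorAlgebra ℂ V} (hv : Y.IsHomogeneous g v)
      (hx : IsMonomial h x) : IsMonomial (g * h) (TensorAlgebra.ι ℂ v * x)

/-- The component of degree `g` of `T(V)` for the `G`-grading extending that of `V`. -/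
def degreePart (g : G) : Submodule ℂ (TensorAlgebra ℂ V) :=
  Submodule.span ℂ {x | Y.IsMonomial g x}

/-- The component of degree `g` of `V ⊗ T(V)`. -/
def tensorDegreePart (g : G) : Submodule ℂ (V ⊗[ℂ] TensorAlgebra ℂ V) :=
  Submodule.span ℂ {t | ∃ h k v x, Y.IsHomogeneous h v ∧ Y.IsMonomial k x ∧ h * k = g ∧
    t = v ⊗ₜ[ℂ] x}

variable {Y} in
theorem IsHomogeneous.ι_mul_mem {g h : G} {v : V} (hv : Y.IsHomogeneous g v)
    {x : TensorAlgebra ℂ V} (hx : x ∈ Y.degreePart h) :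
    TensorAlgebra.ι ℂ v * x ∈ Y.degreePart (g * h) := by
  induction hx using Submodule.span_induction with
  | mem x hx => exact Submodule.subset_span (.ι_mul hv hx)
  | zero => simp
  | add x y _ _ hx hy => rw [mul_add]; exact add_mem hx hy
  | smul c x _ hx => rw [mul_smul_comm]; exact Submodule.smul_mem _ _ hx

theorem iSup_degreePart : ⨆ g, Y.degreePart g = ⊤ := by
  refine (Submodule.eq_top_iff'.2 fun x => ?_)
  induction x using TensorAlgebra.left_induction with
  | h1 => exact Submodule.mem_iSup_of_mem 1 (Submodule.subset_span .one)
  | ha x y hx hy => exact add_mem hx hy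
  | hs c x hx => exact Submodule.smul_mem _ _ hx
  | hι v x hx =>
    have hv : v ∈ Submodule.span ℂ {v | ∃ g, Y.IsHomogeneous g v} :=
      Y.span_isHomogeneous ▸ trivial
    induction hv using Submodule.span_induction with
    | mem v hv =>
      obtain ⟨g, hv⟩ := hv
      induction hx using Submodule.iSup_induction' with
      | mem h x hx => exact Submodule.mem_iSup_of_mem _ (hv.ι_mul_mem hx)
      | zero => simp
      | add x y _ _ hx hy => rw [mul_add]; exact add_mem hx hy
    | zero => simp
    | add v w _ _ hv hw => rw [map_add, add_mul]; exact add_mem hv hw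
    | smul c v _ hv => rw [map_smul, smul_mul_assoc]; exact Submodule.smul_mem _ _ hv

variable {Y} in
theorem IsMonomial.braidedCoprod_mem {g : G} {x : TensorAlgebra ℂ V} (hx : Y.IsMonomial g x) :
    braidedCoprod Y.braiding x ∈ Y.tensorDegreePart g := by
  induction hx with
  | one => simp
  | @ι_mul g h v x hv hx ih =>
    rw [braidedCoprod_ι_mul, hv.braidedMul_tmul]
    refine add_mem (Submodule.subset_span ⟨g, h, v, x, hv, hx, rfl, rfl⟩) ?_
    generalize braidedCoprod Y.braiding x = d at ih
    induction ih using Submodule.span_induction with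
    | mem d hd =>
      obtain ⟨h', k, w, y, hw, hy, rfl, rfl⟩ := hd
      exact Submodule.subset_span
        ⟨_, _, _, _, hw.action g, .ι_mul hv hy, by group, rfl⟩
    | zero => simp
    | add x y _ _ hx hy => rw [map_add]; exact add_mem hx hy
    | smul c x _ hx => rw [map_smul]; exact Submodule.smul_mem _ _ hx

theorem quantumSymmetrizer_mem_degreePart (n : ℕ) {g : G} {x : TensorAlgebra ℂ V}
    (hx : x ∈ Y.degreePart g) : quantumSymmetrizer Y.braiding n x ∈ Y.degreePart g := by
  induction n generalizing g x with
  | zero =>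
    induction hx using Submodule.span_induction with
    | mem x hx =>
      cases hx with
      | one => rw [quantumSymmetrizer_zero_one]; exact Submodule.subset_span .one
      | ι_mul hv hx => rw [quantumSymmetrizer_zero_ι_mul]; exact zero_mem _
    | zero => simp
    | add x y _ _ hx hy => rw [map_add]; exact add_mem hx hy
    | smul c x _ hx => rw [map_smul]; exact Submodule.smul_mem _ _ hx
  | succ n ih =>
    induction hx using Submodule.span_induction with
    | mem x hx =>
      rw [quantumSymmetrizer_succ]
      have hd := IsMonomial.braidedCoprod_mem hx
      generalize braidedCoprod Y.braiding x = d at hd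
      induction hd using Submodule.span_induction with
      | mem d hd =>
        obtain ⟨h, k, w, y, hw, hy, rfl, rfl⟩ := hd
        exact hw.ι_mul_mem (ih (Submodule.subset_span hy))
      | zero => simp
      | add x y _ _ hx hy => rw [map_add, map_add]; exact add_mem hx hy
      | smul c x _ hx => rw [map_smul, map_smul]; exact Submodule.smul_mem _ _ hx
    | zero => simp
    | add x y _ _ hx hy => rw [map_add]; exact add_mem hx hy
    | smul c x _ hx => rw [map_smul]; exact Submodule.smul_mem _ _ hx

theorem braidedRep_tmul_one {g : G} {x : TensorAlgebra ℂ V} (hx : x ∈ Y.degreePart g) (v : V) :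
    braidedRep Y.braiding x (v ⊗ₜ[ℂ] 1) = Y.action g v ⊗ₜ[ℂ] x := by
  induction hx using Submodule.span_induction with
  | mem x hx =>
    induction hx with
    | one => simp
    | ι_mul hw hx ih =>
      rw [map_mul, Module.End.mul_apply, ih, braidedRep_ι, hw.braidedMul_tmul]
      simp
  | zero => simp
  | add x y _ _ hx hy => simp only [map_add, LinearMap.add_apply, hx, hy, TensorProduct.tmul_add]
  | smul c x _ hx =>
    simp only [map_smul, LinearMap.smul_apply, hx, TensorProduct.tmul_smul]

/-- Naturality of the braiding: `𝔖ₙ` commutes with braiding `v` past a tensor. -/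
theorem lTensor_quantumSymmetrizer_braidedRep (n : ℕ) (x : TensorAlgebra ℂ V) (v : V) :
    (quantumSymmetrizer Y.braiding n).lTensor V (braidedRep Y.braiding x (v ⊗ₜ[ℂ] 1)) =
      braidedRep Y.braiding (quantumSymmetrizer Y.braiding n x) (v ⊗ₜ[ℂ] 1) := by
  have hx : x ∈ ⨆ g, Y.degreePart g := Y.iSup_degreePart ▸ trivial
  induction hx using Submodule.iSup_induction' with
  | mem g x hx =>
    rw [Y.braidedRep_tmul_one hx, Y.braidedRep_tmul_one (Y.quantumSymmetrizer_mem_degreePart n hx),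
      LinearMap.lTensor_tmul]
  | zero => simp
  | add x y _ _ hx hy => simp only [map_add, LinearMap.add_apply, hx, hy]

/-- `𝔖ₙ₊₁(x v)` is a function of `𝔖ₙ(x)`, namely its quantum shuffle product with `v`. -/
theorem exists_quantumSymmetrizer_mul_ι (n : ℕ) (v : V) :
    ∃ F : TensorAlgebra ℂ V →ₗ[ℂ] TensorAlgebra ℂ V, ∀ x,
      quantumSymmetrizer Y.braiding (n + 1) (x * TensorAlgebra.ι ℂ v) =
        F (quantumSymmetrizer Y.braiding n x) := by
  -- `M y` is the image of `y v` under braiding `v` past `y`.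
  let M : TensorAlgebra ℂ V →ₗ[ℂ] TensorAlgebra ℂ V :=
    tensorMul ∘ₗ LinearMap.applyₗ (v ⊗ₜ[ℂ] 1) ∘ₗ (braidedRep Y.braiding).toLinearMap
  have key : ∀ n x, quantumSymmetrizer Y.braiding (n + 1) (x * TensorAlgebra.ι ℂ v) =
      tensorMul ((quantumSymmetrizer Y.braiding n ∘ₗ
        LinearMap.mulRight ℂ (TensorAlgebra.ι ℂ v)).lTensor V (braidedCoprod Y.braiding x)) +
      M (quantumSymmetrizer Y.braiding n x) := by
    intro n x
    rw [quantumSymmetrizer_succ, braidedCoprod_mul_ι, map_add, map_add,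
      Y.lTensor_quantumSymmetrizer_braidedRep, LinearMap.lTensor_comp]
    rfl
  induction n with
  | zero =>
    refine ⟨M, fun x => ?_⟩
    have h0 : quantumSymmetrizer Y.braiding 0 ∘ₗ LinearMap.mulRight ℂ (TensorAlgebra.ι ℂ v) = 0 :=
      LinearMap.ext fun y => quantumSymmetrizer_zero_mul_ι Y.braiding v y
    rw [key, h0]
    simp
  | succ n ih =>
    obtain ⟨F, hF⟩ := ih
    refine ⟨tensorMul ∘ₗ F.lTensor V ∘ₗ braidedCoprod 0 + M, fun x => ?_⟩
    have h1 : quantumSymmetrizer Y.braiding (n + 1) ∘ₗ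
        LinearMap.mulRight ℂ (TensorAlgebra.ι ℂ v) = F ∘ₗ quantumSymmetrizer Y.braiding n :=
      LinearMap.ext hF
    rw [key, h1, LinearMap.lTensor_comp]
    simp only [LinearMap.add_apply, LinearMap.comp_apply,
      braidedCoprod_zero_quantumSymmetrizer_succ]

variable {Y} in
/-- `𝔖ₙ₊₁(v x)` is a function of `𝔖ₙ(x)`, namely the quantum shuffle product of `v` with it. -/
theorem IsHomogeneous.exists_quantumSymmetrizer_ι_mul {g : G} {v : V} (hv : Y.IsHomogeneous g v)
    (n : ℕ) : ∃ F : TensorAlgebra ℂ V →ₗ[ℂ] TensorAlgebra ℂ V, ∀ x,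
      quantumSymmetrizer Y.braiding (n + 1) (TensorAlgebra.ι ℂ v * x) =
        F (quantumSymmetrizer Y.braiding n x) := by
  have key : ∀ n x, quantumSymmetrizer Y.braiding (n + 1) (TensorAlgebra.ι ℂ v * x) =
      TensorAlgebra.ι ℂ v * quantumSymmetrizer Y.braiding n x +
      tensorMul (TensorProduct.map (Y.action g) (quantumSymmetrizer Y.braiding n ∘ₗ
        LinearMap.mulLeft ℂ (TensorAlgebra.ι ℂ v)) (braidedCoprod Y.braiding x)) := by
    intro n x
    rw [quantumSymmetrizer_succ, braidedCoprod_ι_mul, hv.braidedMul_tmul, map_add, map_add,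
      ← LinearMap.lTensor_comp_map]
    rfl
  induction n with
  | zero =>
    refine ⟨LinearMap.mulLeft ℂ (TensorAlgebra.ι ℂ v), fun x => ?_⟩
    have h0 : quantumSymmetrizer Y.braiding 0 ∘ₗ LinearMap.mulLeft ℂ (TensorAlgebra.ι ℂ v) = 0 :=
      LinearMap.ext fun y => quantumSymmetrizer_zero_ι_mul Y.braiding v y
    rw [key, h0]
    simp
  | succ n ih =>
    obtain ⟨F, hF⟩ := ih
    refine ⟨LinearMap.mulLeft ℂ (TensorAlgebra.ι ℂ v) +
      tensorMul ∘ₗ TensorProduct.map (Y.action g) F ∘ₗ braidedCoprod 0, fun x => ?_⟩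
    have h1 : quantumSymmetrizer Y.braiding (n + 1) ∘ₗ
        LinearMap.mulLeft ℂ (TensorAlgebra.ι ℂ v) = F ∘ₗ quantumSymmetrizer Y.braiding n :=
      LinearMap.ext hF
    rw [key, h1, ← LinearMap.map_comp_lTensor]
    simp only [LinearMap.add_apply, LinearMap.comp_apply,
      braidedCoprod_zero_quantumSymmetrizer_succ, LinearMap.mulLeft_apply]

/-- The tensors killed by all quantum symmetrizers. -/
def symmetrizerKer : Submodule ℂ (TensorAlgebra ℂ V) :=
  ⨅ n, LinearMap.ker (quantumSymmetrizer Y.braiding n)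

theorem mem_symmetrizerKer {x : TensorAlgebra ℂ V} :
    x ∈ Y.symmetrizerKer ↔ ∀ n, quantumSymmetrizer Y.braiding n x = 0 := by
  simp [symmetrizerKer]

theorem mul_mem_symmetrizerKer_right (x : TensorAlgebra ℂ V) {y : TensorAlgebra ℂ V}
    (hy : y ∈ Y.symmetrizerKer) : y * x ∈ Y.symmetrizerKer := by
  induction x using TensorAlgebra.induction generalizing y with
  | algebraMap r => rw [← Algebra.commutes, ← Algebra.smul_def]; exact Submodule.smul_mem _ _ hy
  | ι v =>
    rw [mem_symmetrizerKer] at hy ⊢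
    rintro (_ | n)
    · exact quantumSymmetrizer_zero_mul_ι _ _ _
    · obtain ⟨F, hF⟩ := Y.exists_quantumSymmetrizer_mul_ι n v
      rw [hF, hy, map_zero]
  | mul a b ha hb => rw [← mul_assoc]; exact hb (ha hy)
  | add a b ha hb => rw [mul_add]; exact add_mem (ha hy) (hb hy)

theorem mul_mem_symmetrizerKer_left (x : TensorAlgebra ℂ V) {y : TensorAlgebra ℂ V}
    (hy : y ∈ Y.symmetrizerKer) : x * y ∈ Y.symmetrizerKer := by
  induction x using TensorAlgebra.induction generalizing y with
  | algebraMap r => rw [← Algebra.smul_def]; exact Submodule.smul_mem _ _ hy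
  | ι v =>
    have hv : v ∈ Submodule.span ℂ {v | ∃ g, Y.IsHomogeneous g v} :=
      Y.span_isHomogeneous ▸ trivial
    induction hv using Submodule.span_induction with
    | mem v hv =>
      obtain ⟨g, hv⟩ := hv
      rw [mem_symmetrizerKer] at hy ⊢
      rintro (_ | n)
      · exact quantumSymmetrizer_zero_ι_mul _ _ _
      · obtain ⟨F, hF⟩ := hv.exists_quantumSymmetrizer_ι_mul n
        rw [hF, hy, map_zero]
    | zero => simp
    | add v w _ _ hv hw => rw [map_add, add_mul]; exact add_mem hv hw
    | smul c v _ hv => rw [map_smul, smul_mul_assoc]; exact Submodule.smul_mem _ _ hv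
  | mul a b ha hb => rw [mul_assoc]; exact ha (hb hy)
  | add a b ha hb => rw [add_mul]; exact add_mem (ha hy) (hb hy)

/-- The congruence identifying two tensors on which all quantum symmetrizers agree. -/
def symmetrizerCon : RingCon (TensorAlgebra ℂ V) where
  r x y := ∀ n, quantumSymmetrizer Y.braiding n x = quantumSymmetrizer Y.braiding n y
  iseqv := ⟨fun _ _ => rfl, fun h n => (h n).symm, fun h h' n => (h n).trans (h' n)⟩
  add' h h' n := by rw [map_add, map_add, h, h']
  mul' {w x y z} h h' := by
    have h1 : (w - x) * y + x * (y - z) ∈ Y.symmetrizerKer :=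
      add_mem
        (Y.mul_mem_symmetrizerKer_right y (Y.mem_symmetrizerKer.2 fun n => by
          rw [map_sub, h, sub_self]))
        (Y.mul_mem_symmetrizerKer_left x (Y.mem_symmetrizerKer.2 fun n => by
          rw [map_sub, h', sub_self]))
    have h2 : (w - x) * y + x * (y - z) = w * y - x * z := by noncomm_ring
    rw [h2, mem_symmetrizerKer] at h1
    exact fun n => sub_eq_zero.1 ((map_sub _ _ _).symm.trans (h1 n))

/-- In the Nichols algebra of a Yetter-Drinfeld module no more tensors are identified than the
quantum symmetrizers demand, since these already define a congruence. -/
theorem mkAlgHom_nichols_eq_iff {x y : TensorAlgebra ℂ V} :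
    (RingQuot.mkAlgHom ℂ _ x : NicholsAlgebra Y.braiding) = RingQuot.mkAlgHom ℂ _ y ↔
      ∀ n, quantumSymmetrizer Y.braiding n x = quantumSymmetrizer Y.braiding n y := by
  refine ⟨fun h => ?_, fun h => RingQuot.mkAlgHom_rel ℂ h⟩
  have hw : ∀ ⦃x y : TensorAlgebra ℂ V⦄,
      (∀ n, quantumSymmetrizer Y.braiding n x = quantumSymmetrizer Y.braiding n y) →
        Y.symmetrizerCon.mk' x = Y.symmetrizerCon.mk' y :=
    fun x y h => (RingCon.eq _).2 h
  have h1 : ∀ z, RingQuot.lift ⟨Y.symmetrizerCon.mk', hw⟩ (RingQuot.mkAlgHom ℂ _ z) =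
      Y.symmetrizerCon.mk' z := by
    intro z
    rw [← RingQuot.lift_mkRingHom_apply _ hw, ← RingQuot.mkAlgHom_coe ℂ]
    rfl
  have h2 := congrArg (RingQuot.lift ⟨Y.symmetrizerCon.mk', hw⟩) h
  rw [h1, h1] at h2
  exact (RingCon.eq _).1 h2

/-- An injective map of braided vector spaces between Yetter-Drinfeld modules, possibly over
different groups, induces an injective map of Nichols algebras; so if that of its target is finite
dimensional, then so is that of its source. -/
theorem finite_nichols_of_injective {G' : Type*} [Group G'] {W : Type*} [AddCommGroup W]
    [Module ℂ W] (Y' : YetterDrinfeld G' W) (f : V →ₗ[ℂ] W) (hf : Function.Injective f)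
    (hc : Y'.braiding ∘ₗ TensorProduct.map f f = TensorProduct.map f f ∘ₗ Y.braiding)
    [Module.Finite ℂ (NicholsAlgebra Y'.braiding)] :
    Module.Finite ℂ (NicholsAlgebra Y.braiding) := by
  let F : NicholsAlgebra Y.braiding →ₐ[ℂ] NicholsAlgebra Y'.braiding :=
    RingQuot.liftAlgHom ℂ ⟨(RingQuot.mkAlgHom ℂ _).comp (tensorAlgebraMap f), fun x y h =>
      Y'.mkAlgHom_nichols_eq_iff.2 fun n => by
        change quantumSymmetrizer Y'.braiding n (tensorAlgebraMap f x) =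
          quantumSymmetrizer Y'.braiding n (tensorAlgebraMap f y)
        rw [quantumSymmetrizer_tensorAlgebraMap hc, quantumSymmetrizer_tensorAlgebraMap hc, h]⟩
  have hFmk : ∀ x, F (RingQuot.mkAlgHom ℂ _ x) = RingQuot.mkAlgHom ℂ _ (tensorAlgebraMap f x) :=
    fun x => RingQuot.liftAlgHom_mkAlgHom_apply ℂ _ _ x
  have hF : Function.Injective F := by
    intro a b hab
    obtain ⟨x, rfl⟩ := RingQuot.mkAlgHom_surjective ℂ _ a
    obtain ⟨y, rfl⟩ := RingQuot.mkAlgHom_surjective ℂ _ b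
    rw [hFmk, hFmk] at hab
    refine Y.mkAlgHom_nichols_eq_iff.2 fun n => tensorAlgebraMap_injective f hf ?_
    rw [← quantumSymmetrizer_tensorAlgebraMap hc, ← quantumSymmetrizer_tensorAlgebraMap hc]
    exact Y'.mkAlgHom_nichols_eq_iff.1 hab n
  exact Module.Finite.of_injective F.toLinearMap hF

end YetterDrinfeld

namespace HopfBimoduleQuiver.Embedding

variable {D G : Type*} [Group D] [Group G] {Q : HopfBimoduleQuiver D} {Q' : HopfBimoduleQuiver G}
  (E : Embedding Q Q')

theorem arrowMap_mem_supported {m : Q.Arrow →₀ ℂ}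
    (hm : m ∈ Finsupp.supported ℂ ℂ {a | Q.src a = 1}) :
    E.arrowMap m ∈ Finsupp.supported ℂ ℂ {a | Q'.src a = 1} := by
  rw [Finsupp.supported_eq_span_single] at hm
  induction hm using Submodule.span_induction with
  | mem m hm =>
    obtain ⟨a, ha, rfl⟩ := hm
    refine Finsupp.supported_mono ?_ (E.arrowMap_arr_mem a)
    rintro b ⟨hb, -⟩
    exact hb.trans (by rw [show Q.src a = 1 from ha, map_one])
  | zero => simp
  | add m n _ _ h1 h2 => simp only [map_add]; exact add_mem h1 h2
  | smul c m _ h => simp only [map_smul]; exact Submodule.smul_mem _ _ h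

/-- The restriction of the arrow map to the arrows that start at `1`. -/
def arrowsFromOneMap : Q.ArrowsFromOne →ₗ[ℂ] Q'.ArrowsFromOne :=
  E.arrowMap.restrict fun _ hm => E.arrowMap_mem_supported hm

theorem arrowsFromOneMap_injective : Function.Injective E.arrowsFromOneMap :=
  fun _ _ h => Subtype.ext (E.arrowMap_injective congr(($h).1))

theorem arrowsFromOneMap_ad (g : D) (m : Q.ArrowsFromOne) :
    E.arrowsFromOneMap (Q.ad g m) = Q'.ad (E.toMonoidHom g) (E.arrowsFromOneMap m) := by
  refine Subtype.ext ?_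
  change E.arrowMap (Q.left g (Q.right (.op g⁻¹) (m : Q.Arrow →₀ ℂ))) =
    Q'.left (E.toMonoidHom g) (Q'.right (.op (E.toMonoidHom g)⁻¹) (E.arrowMap m))
  rw [E.arrowMap_left, E.arrowMap_right, map_inv]

theorem braiding_comp_map : Q'.yetterDrinfeld.braiding ∘ₗ
      TensorProduct.map E.arrowsFromOneMap E.arrowsFromOneMap =
    TensorProduct.map E.arrowsFromOneMap E.arrowsFromOneMap ∘ₗ Q.yetterDrinfeld.braiding := by
  refine TensorProduct.ext (supported_ext fun a ha => LinearMap.ext fun m => ?_)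
  have h1 : Q.yetterDrinfeld.IsHomogeneous (Q.tgt a)
      ⟨Q.arr a, Finsupp.single_mem_supported ℂ _ ha⟩ := Q.coaction_arr a ha
  have h2 : E.arrowMap (Q.arr a) ∈ Q'.arrows 1 (E.toMonoidHom (Q.tgt a)) := by
    have := E.arrowMap_arr_mem a
    rwa [show Q.src a = 1 from ha, map_one] at this
  have h3 : Q'.yetterDrinfeld.IsHomogeneous (E.toMonoidHom (Q.tgt a))
      (E.arrowsFromOneMap ⟨Q.arr a, Finsupp.single_mem_supported ℂ _ ha⟩) := Q'.coaction_eq h2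
  change Q'.yetterDrinfeld.braiding (E.arrowsFromOneMap ⟨Q.arr a, _⟩ ⊗ₜ E.arrowsFromOneMap m) =
    TensorProduct.map E.arrowsFromOneMap E.arrowsFromOneMap
      (Q.yetterDrinfeld.braiding (⟨Q.arr a, _⟩ ⊗ₜ m))
  rw [h3.braiding_tmul, h1.braiding_tmul, TensorProduct.map_tmul]
  exact congrArg (· ⊗ₜ[ℂ] _) (E.arrowsFromOneMap_ad _ m).symm

theorem finite_nichols (E : Embedding Q Q')
    [Module.Finite ℂ (NicholsAlgebra Q'.yetterDrinfeld.braiding)] :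
    Module.Finite ℂ (NicholsAlgebra Q.yetterDrinfeld.braiding) :=
  Q.yetterDrinfeld.finite_nichols_of_injective Q'.yetterDrinfeld E.arrowsFromOneMap
    E.arrowsFromOneMap_injective E.braiding_comp_map

end HopfBimoduleQuiver.Embedding


/-! ### The embedding of arrow bimodules attached to a sub-RSR -/

namespace RSR

variable {G : Type u} [Group G]

/-- An irreducible representation is nonzero, so a class that carries one is ramified. -/
theorem r_ne_zero (R : RSR.{u, v} G) {C : ConjClasses G} (i : R.I C) : R.r C ≠ 0 := by
  have h1 : Nontrivial (R.X C i) := by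
    by_contra hX
    rw [not_nontrivial_iff_subsingleton] at hX
    have := R.irreducible C i
    obtain ⟨a, b, hab⟩ := this.toNontrivial
    exact hab (SetLike.ext fun x => by
      rw [Subsingleton.elim x 0]; exact ⟨fun _ => b.toSubmodule.zero_mem,
        fun _ => a.toSubmodule.zero_mem⟩)
  have h2 : Nontrivial (⨁ i, R.X C i) := by
    classical exact (DirectSum.of_injective (β := R.X C) i).nontrivial
  rw [← R.deg]
  exact rank_pos.ne'

namespace Choice

variable {R : RSR.{u, v} G} (P : R.Choice)

/-- The projection of `kQ₁` to the representation space of the arrows `a_{y,x}^{(i,j)}`, `j ∈ J`,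
for fixed `x`, `y` and `i`. -/
def block {x y : G} {C : ConjClasses G} (h : ConjClasses.mk (x⁻¹ * y) = C) (i : R.I C) :
    (P.Arrow →₀ ℂ) →ₗ[ℂ] R.X C i :=
  (P.basis C i).repr.symm.toLinearMap ∘ₗ
    Finsupp.lcomapDomain (fun j => (⟨x, y, C, h, i, j⟩ : P.Arrow)) fun _ _ hj => by simpa using hj

variable {P} in
theorem eq_zero_of_block_eq_zero {m : P.Arrow →₀ ℂ}
    (hm : ∀ (x y : G) (C : ConjClasses G) (h : ConjClasses.mk (x⁻¹ * y) = C) (i : R.I C),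
      P.block h i m = 0) : m = 0 := by
  ext a
  have h := congrArg (fun v => (P.basis a.C a.i).repr v a.j) (hm _ _ _ a.mk_eq a.i)
  simpa [block, Finsupp.lcomapDomain] using h

theorem block_single {x y : G} {C : ConjClasses G} (h : ConjClasses.mk (x⁻¹ * y) = C) (i : R.I C)
    (j : P.J C i) : P.block h i (Finsupp.single ⟨x, y, C, h, i, j⟩ 1) = P.basis C i j := by
  rw [← (P.basis C i).repr_symm_single_one]
  simp only [block, LinearMap.comp_apply, LinearEquiv.coe_coe]
  congr 1
  ext j'
  classical
  simp [Finsupp.lcomapDomain, Finsupp.single_apply]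

theorem block_single_of_ne {x y : G} {C : ConjClasses G} (h : ConjClasses.mk (x⁻¹ * y) = C)
    (i : R.I C) {a : P.Arrow} (ha : ∀ j, a ≠ ⟨x, y, C, h, i, j⟩) :
    P.block h i (Finsupp.single a 1) = 0 := by
  simp only [block, LinearMap.comp_apply, LinearEquiv.coe_coe, LinearEquiv.map_eq_zero_iff]
  ext j
  classical
  simp [Finsupp.lcomapDomain, ha j]

theorem block_arrowVec {x y : G} {C : ConjClasses G} (h : ConjClasses.mk (x⁻¹ * y) = C)
    (i : R.I C) (v : R.X C i) : P.block h i (P.arrowVec h i v) = v := by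
  have : P.block h i ∘ₗ P.arrowVec h i = LinearMap.id :=
    (P.basis C i).ext fun j => by simp [arrowVec, block_single]
  exact congr($this v)

theorem block_arrowVec_of_ne {x y x' y' : G} {C C' : ConjClasses G}
    (h : ConjClasses.mk (x⁻¹ * y) = C) (i : R.I C) (h' : ConjClasses.mk (x'⁻¹ * y') = C')
    (i' : R.I C') (hne : ∀ j j', (⟨x', y', C', h', i', j'⟩ : P.Arrow) ≠ ⟨x, y, C, h, i, j⟩)
    (v : R.X C' i') : P.block h i (P.arrowVec h' i' v) = 0 := by
  have : P.block h i ∘ₗ P.arrowVec h' i' = 0 :=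
    (P.basis C' i').ext fun j' => by
      simpa [arrowVec] using P.block_single_of_ne h i fun j => hne j j'
  exact congr($this v)

end Choice

namespace IsSubRSR

variable {D : Subgroup G} {R : RSR.{u, v} D} {R' : RSR.{u, v} G} (hle : R.IsSubRSR R')

theorem coe_u (hle : R.IsSubRSR R') {C : ConjClasses D} (i : R.I C) :
    (R.u C : G) = R'.u (C.map D.subtype) :=
  (hle C (R.r_ne_zero i)).2.1

/-- The inclusion `I_C ⊆ I'_{C_G}`. -/
def index {C : ConjClasses D} (i : R.I C) : R'.I (C.map D.subtype) :=
  (hle C (R.r_ne_zero i)).2.2.choose i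

theorem index_injective {C : ConjClasses D} :
    Function.Injective (hle.index : R.I C → R'.I (C.map D.subtype)) :=
  fun i _ h => (hle C (R.r_ne_zero i)).2.2.choose.injective h

/-- An embedding of `ρ_C^{(i)}` in the restriction of the representation of `G^{u(C)}` with the same
index. -/
def incl {C : ConjClasses D} (i : R.I C) :
    R.X C i →ₗ[ℂ] R'.X (C.map D.subtype) (hle.index i) :=
  ((hle C (R.r_ne_zero i)).2.2.choose_spec i).choose

theorem incl_injective {C : ConjClasses D} (i : R.I C) : Function.Injective (hle.incl i) :=
  ((hle C (R.r_ne_zero i)).2.2.choose_spec i).choose_spec.1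

theorem incl_ρ {C : ConjClasses D} (i : R.I C) (d : Subgroup.centralizer {R.u C})
    (d' : Subgroup.centralizer {R'.u (C.map D.subtype)}) (h : ((d : D) : G) = d')
    (v : R.X C i) : hle.incl i (R.ρ C i d v) = R'.ρ _ (hle.index i) d' (hle.incl i v) :=
  ((hle C (R.r_ne_zero i)).2.2.choose_spec i).choose_spec.2 d d' h v

theorem mk_coe {x y : D} {C : ConjClasses D} (hC : ConjClasses.mk (x⁻¹ * y) = C) :
    ConjClasses.mk ((x : G)⁻¹ * (y : G)) = C.map D.subtype := by
  subst hC; rfl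

variable (P : R.Choice) (P' : R'.Choice)

/-- The element `g'_t g_t⁻¹` of `G^{u(C)}` that compares the coset representatives of the two
systems at `t ∈ C`. -/
def twist (hle : R.IsSubRSR R') (P : R.Choice) (P' : R'.Choice) {C : ConjClasses D} {t : D}
    (ht : ConjClasses.mk t = C) (i : R.I C) :
    Subgroup.centralizer {R'.u (C.map D.subtype)} :=
  ⟨P'.coset (t : G) * (P.coset t : G)⁻¹, by
    have h1 := congrArg (Subtype.val : D → G) (P.coset_spec t)
    have h2 := P'.coset_spec (t : G)
    have h3 := hle.coe_u i
    subst ht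
    rw [show ConjClasses.mk (t : G) = (ConjClasses.mk t).map D.subtype from rfl, ← h3] at h2
    simp only [Subgroup.coe_mul, Subgroup.coe_inv] at h1
    rw [Subgroup.mem_centralizer_singleton_iff, ← h3]
    set w : G := ((R.u (ConjClasses.mk t) : D) : G)
    set c : G := ((P.coset t : D) : G)
    set c' : G := P'.coset t
    calc c' * c⁻¹ * w = c' * (c⁻¹ * w * c) * c⁻¹ := by group
      _ = c' * (c'⁻¹ * w * c') * c⁻¹ := by rw [h1, h2]
      _ = w * (c' * c⁻¹) := by group⟩

/-- The map of arrow spaces: the vector `v` of `ρ_C^{(i)}` at `x → y` goes to `g'_t g_t⁻¹ v` at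
`x → y`, where `t = x⁻¹ y`. The factor `g'_t g_t⁻¹` accounts for the different coset representatives
that enter the right actions of the two systems. -/
def arrowMap : (P.Arrow →₀ ℂ) →ₗ[ℂ] P'.Arrow →₀ ℂ :=
  Finsupp.linearCombination ℂ fun a => P'.arrowVec (mk_coe a.mk_eq) (hle.index a.i)
    (R'.ρ _ _ (hle.twist P P' a.mk_eq a.i) (hle.incl a.i (P.basis a.C a.i a.j)))

theorem arrowMap_arrowVec {x y : D} {C : ConjClasses D} (hC : ConjClasses.mk (x⁻¹ * y) = C)
    (i : R.I C) (v : R.X C i) : hle.arrowMap P P' (P.arrowVec hC i v) =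
      P'.arrowVec (mk_coe hC) (hle.index i) (R'.ρ _ _ (hle.twist P P' hC i) (hle.incl i v)) := by
  have : hle.arrowMap P P' ∘ₗ P.arrowVec hC i = P'.arrowVec (mk_coe hC) (hle.index i) ∘ₗ
      R'.ρ _ _ (hle.twist P P' hC i) ∘ₗ hle.incl i :=
    (P.basis C i).ext fun j => by simp [Choice.arrowVec, arrowMap]
  exact congr($this v)

theorem block_arrowMap {x y : D} {C : ConjClasses D} (hC : ConjClasses.mk (x⁻¹ * y) = C)
    (i : R.I C) (m : P.Arrow →₀ ℂ) : P'.block (mk_coe hC) (hle.index i) (hle.arrowMap P P' m) =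
      R'.ρ _ _ (hle.twist P P' hC i) (hle.incl i (P.block hC i m)) := by
  have : P'.block (mk_coe hC) (hle.index i) ∘ₗ hle.arrowMap P P' =
      R'.ρ _ _ (hle.twist P P' hC i) ∘ₗ hle.incl i ∘ₗ P.block hC i := by
    refine Finsupp.lhom_ext' fun a => LinearMap.ext_ring ?_
    simp only [LinearMap.comp_apply, Finsupp.lsingle_apply]
    by_cases ha : ∃ j, a = ⟨x, y, C, hC, i, j⟩
    · obtain ⟨j, rfl⟩ := ha
      rw [P.single_eq_arrowVec, arrowMap_arrowVec, Choice.block_arrowVec, Choice.block_arrowVec]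
    · rw [P.block_single_of_ne hC i fun j hj => ha ⟨j, hj⟩, map_zero, map_zero,
        P.single_eq_arrowVec, arrowMap_arrowVec, Choice.block_arrowVec_of_ne]
      -- The arrow `a` is determined up to `j` by its ends and the image of its index `i`.
      obtain ⟨x', y', C', h', i', j'⟩ := a
      intro k k' hk
      simp only [Choice.Arrow.mk.injEq] at hk
      obtain ⟨hx, hy, -, hi, -⟩ := hk
      obtain rfl := Subtype.ext hx
      obtain rfl := Subtype.ext hy
      obtain rfl : C' = C := h'.symm.trans hC
      obtain rfl := hle.index_injective (eq_of_heq hi)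
      exact ha ⟨j', rfl⟩
  exact congr($this m)

theorem arrowMap_injective : Function.Injective (hle.arrowMap P P') := by
  rw [injective_iff_map_eq_zero]
  intro m hm
  refine Choice.eq_zero_of_block_eq_zero fun x y C hC i => hle.incl_injective i ?_
  have h := hle.block_arrowMap P P' hC i m
  rw [hm, map_zero] at h
  rw [map_zero]
  exact (R'.ρ _ _).apply_bijective (hle.twist P P' hC i) |>.1 (by rw [← h, map_zero])

theorem arrowMap_leftAction (g : D) (m : P.Arrow →₀ ℂ) :
    hle.arrowMap P P' (P.leftAction g m) = P'.leftAction (g : G) (hle.arrowMap P P' m) := by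
  have : hle.arrowMap P P' ∘ₗ P.leftAction g = P'.leftAction (g : G) ∘ₗ hle.arrowMap P P' := by
    refine Finsupp.lhom_ext' fun a => LinearMap.ext_ring ?_
    have ht : hle.twist P P' (Choice.mk_left a.mk_eq g) a.i = hle.twist P P' a.mk_eq a.i := by
      have h1 : (g * a.src)⁻¹ * (g * a.tgt) = a.src⁻¹ * a.tgt := by group
      apply Subtype.ext
      simp only [twist, h1]
    simp only [LinearMap.comp_apply, Finsupp.lsingle_apply, P.single_eq_arrowVec,
      Choice.leftAction_arrowVec, arrowMap_arrowVec, ht]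
  exact congr($this m)

theorem arrowMap_rightLin (g : D) (m : P.Arrow →₀ ℂ) :
    hle.arrowMap P P' (P.rightLin g m) = P'.rightLin (g : G) (hle.arrowMap P P' m) := by
  have : hle.arrowMap P P' ∘ₗ P.rightLin g = P'.rightLin (g : G) ∘ₗ hle.arrowMap P P' := by
    refine Finsupp.lhom_ext' fun a => LinearMap.ext_ring ?_
    simp only [LinearMap.comp_apply, Finsupp.lsingle_apply, P.single_eq_arrowVec,
      Choice.rightLin_arrowVec, arrowMap_arrowVec]
    -- Both sides are given by the element `g'_s g⁻¹ g_t⁻¹`, where `s = g⁻¹ t g`.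
    have hd : (((P.zeta a.mk_eq g)⁻¹ : D) : G) =
        ((hle.twist P P' (Choice.mk_right a.mk_eq g) a.i)⁻¹ *
          (P'.zeta (mk_coe a.mk_eq) (g : G))⁻¹ * hle.twist P P' a.mk_eq a.i :
            Subgroup.centralizer {R'.u (a.C.map D.subtype)}) := by
      have h1 : (a.src * g)⁻¹ * (a.tgt * g) = g⁻¹ * (a.src⁻¹ * a.tgt) * g := by group
      simp only [twist, Choice.zeta, h1, Subgroup.coe_mul, Subgroup.coe_inv]
      group
    rw [hle.incl_ρ a.i _ _ hd, ← Module.End.mul_apply, ← map_mul, mul_assoc, mul_inv_cancel_left,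
      map_mul]
    rfl
  exact congr($this m)

theorem arrowMap_single_mem (a : P.Arrow) : hle.arrowMap P P' (Finsupp.single a 1) ∈
    Finsupp.supported ℂ ℂ {b : P'.Arrow | b.src = (a.src : G) ∧ b.tgt = (a.tgt : G)} := by
  rw [P.single_eq_arrowVec, arrowMap_arrowVec]
  exact P'.arrowVec_mem _ _ _

/-- The embedding of the Hopf quiver of a sub-RSR. -/
def embedding : HopfBimoduleQuiver.Embedding P.quiver P'.quiver where
  toMonoidHom := D.subtype
  injective := D.subtype_injective
  arrowMap := hle.arrowMap P P'
  arrowMap_injective := hle.arrowMap_injective P P'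
  arrowMap_arr_mem := hle.arrowMap_single_mem P P'
  arrowMap_left := hle.arrowMap_leftAction P P'
  arrowMap_right := hle.arrowMap_rightLin P P'

end IsSubRSR

end RSR

end

theorem proposition1p6 {G : Type u} [Group G] (D : Subgroup G)
    (R : RSR.{u, v} D) (R' : RSR.{u, v} G) (hle : R.IsSubRSR R')
    (P : R.Choice) (P' : R'.Choice) :
    (∃ f : P.CoPathHopfAlgebra →ₐc[ℂ] P'.CoPathHopfAlgebra,
      IsHopfEmbedding f ∧
      (∀ x : D, f (P.quiver.vert x) = P'.quiver.vert (x : G)) ∧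
      ∃ g : P.OneTypeHopfAlgebra →ₐc[ℂ] P'.OneTypeHopfAlgebra,
        IsHopfEmbedding g ∧
        ∀ h : P.OneTypeHopfAlgebra,
          ((g h : P'.OneTypeHopfAlgebra) : P'.CoPathHopfAlgebra) = f (h : P.CoPathHopfAlgebra)) ∧
    (Finite G → Module.Finite ℂ P'.Nichols → Module.Finite ℂ P.Nichols) := by
  refine ⟨⟨(hle.embedding P P').coPathHom, (hle.embedding P P').isHopfEmbedding_coPathHom,
    (hle.embedding P P').coPathMap_vert,
    HopfSubalgebra.restrictHom (hle.embedding P P').coPathHom _ _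
      fun _ => (hle.embedding P P').coPathHom_mem_oneType,
    ⟨fun a b hab => ?_, BialgHom.map_antipode _⟩, fun _ => rfl⟩,
    fun _ _ => (hle.embedding P P').finite_nichols⟩
  exact Subtype.ext ((hle.embedding P P').coPathMap_injective (congrArg Subtype.val hab))
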